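/- **Problem.** Let $N\ge 1$, $\mathbb R^n=\mathbb R^{n_1}\times\dots\times\mathbb R^{n_N}$ with the Euclidean norm, $\mathbf U=\mathbf U_1\times\dots\times\mathbf U_N$ with $\mathbf U_i\subset\mathbb R^{n_i}$ closed and convex, and let $\mathbf C\subset\mathbb R^m$ be a nonempty closed convex cone, $\mathbf C^*=\{y:\langle y,x\rangle\ge 0\ \forall x\in\mathbf C\}$, $\Pi$ the projection onto $\mathbf C^*$. Consider $$\min\ F(u)=G(u)+J(u)\quad\text{s.t.}\quad \Theta(u)=\Omega(u)+\Phi(u)\in-\mathbf C,\ u\in\mathbf U,$$ with $J(u)=\sum_{i=1}^N J_i(u_i)$ and $\Phi(u)=\sum_{i=1}^N\Phi_i(u_i)$. Assume: $J$ is real-valued, convex and lower semicontinuous on $\mathbf U$; $G$ is convex on $\mathbf U$ and differentiable at the points of $\mathbf U$, with gradient Lipschitz on $\mathbf U$ with constant $B_G\ge 0$; $\Omega$ and $\Phi$ are $\mathbf C$-convex on $\mathbf U$ (that is, $f(\alpha u+(1-\alpha)v)-\alpha f(u)-(1-\alpha)f(v)\in-\mathbf C$ for $u,v\in\mathbf U$,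 $\alpha\in[0,1]$); $\Omega$ is differentiable at the points of $\mathbf U$ and, for some $T\in\mathbf C$, $(\nabla\Omega(u)-\nabla\Omega(v))(u-v)-\|u-v\|^2T\in-\mathbf C$ for all $u,v\in\mathbf U$; $\Theta$ is Lipschitz on $\mathbf U$ with constant $\tau>0$. Let $L(u,p)=F(u)+\langle p,\Theta(u)\rangle$ and let $(u^*,p^*)\in\mathbf U\times\mathbf C^*$ be a saddle point: $L(u^*,p)\le L(u^*,p^*)\le L(u,p^*)$ for all $u\in\mathbf U$, $p\in\mathbf C^*$. For $\gamma>0$ put $L_\gamma(u,p)=F(u)+\frac{1}{2\gamma}\big[\|\Pi(p+\gamma\Theta(u))\|^2-\|p\|^2\big]$. **Algorithm.** Let $K(u)=\sum_{i=1}^N K_i(u_i)$ be strongly convex on $\mathbf U$ with constant $\beta>0$ and differentiable at the points of $\mathbf U$ with gradient Lipschitz on $\mathbf U$, and let $D(u,v)=K(u)-K(v)-\langle\nabla K(v),u-v\rangle$. Let $\rho=\gamma/(2N-1)$, let $\mu_0\ge\|p^*\|$ (for instance, a bound for the norms of all dual optimal solutions), $\mu=\mu_0+1$, and let $\mathcal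 P_\mu$ be the projection onto $\{p\in\mathbb R^m:\|p\|\le\mu\}$. Start from $u^0\in\mathbf U$, $p^0\in\mathbb R^m$, $\epsilon^{-1}>0$ (the step size with index $-1$). For $k=0,1,\dots$, with $q^k=\Pi(p^k+\gamma\Theta(u^k))$, set $$\epsilon^k=\min\Big\{\epsilon^{k-1},\ \frac{\beta}{2(B_G+\|q^k\|\,\|T\|+\gamma\tau^2)}\Big\},$$ draw $i(k)$ uniformly from $\{1,\dots,N\}$, independently of the other draws, and let $$u^{k+1}=\arg\min_{u\in\mathbf U}\ \langle\nabla_{i(k)}G(u^k),u_{i(k)}\rangle+J_{i(k)}(u_{i(k)})+\langle q^k,\nabla_{i(k)}\Omega(u^k)u_{i(k)}+\Phi_{i(k)}(u_{i(k)})\rangle+\tfrac1{\epsilon^k}D(u,u^k),$$ $$p^{k+1}=\mathcal P_\mu\Big(p^k+\tfrac{\rho}{\gamma}\big(\Pi(p^k+\gamma\Theta(u^{k+1}))-p^k\big)\Big).$$ Put $\bar u_t=\sum_{k=0}^t\epsilon^ku^{k+1}\big/\sum_{k=0}^t\epsilon^k$, $d_3=\sup_{\|p\|<\mu}h_3(u^*,p)$,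 where $$h_3(u,p)=D(u,u^0)+\tfrac{N-1}{N}D(u^*,u^0)+\tfrac{\epsilon^0}{\gamma}\|p-p^0\|^2+\tfrac{(2N-1)(N-1)\epsilon^0}{N^2}\Big[\tfrac{\|p^*-p^0\|^2}{2\gamma}+L_\gamma(u^0,p^0)-L(u^*,p^*)\Big].$$ **Claim.** Let $t\in\{0,1,2,\dots\}$ and let $\underline\epsilon>0$ be such that $\epsilon^k\ge\underline\epsilon$ almost surely for $k=0,\dots,t$ (in particular, any positive almost sure lower bound of the whole sequence $(\epsilon^k)$ is admitted, for every $t$). Then $|F(\bar u_t)-F(u^*)|+\|\Pi(\Theta(\bar u_t))\|$ is integrable and $$\mathbb E\big\{|F(\bar u_t)-F(u^*)|+\|\Pi(\Theta(\bar u_t))\|\big\}\le\frac{(\mu+1)Nd_3}{(\mu-\|p^*\|)\,\underline\epsilon\,(t+1)}.$$ Moreover, for all $\varepsilon>0$ and $\eta\in(0,1)$, if $$t\ \ge\ T_{\varepsilon,\eta}:=\frac{(\mu+1)Nd_3}{\varepsilon\,\eta\,\underline\epsilon\,(\mu-\|p^*\|)}-1,$$ then $$\mathbb P\big\{|F(\bar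 u_t)-F(u^*)|+\|\Pi(\Theta(\bar u_t))\|\le\varepsilon\big\}\ge 1-\eta,$$ and $$\mathbb P\big\{|F(\bar u_t)-F(u^*)|+\|\Pi(\Theta(\bar u_t))\|\ge\varepsilon\big\}\le\varepsilon^{-1}\,\mathbb E\big\{|F(\bar u_t)-F(u^*)|+\|\Pi(\Theta(\bar u_t))\|\big\}\le\frac{(\mu+1)Nd_3}{\varepsilon(\mu-\|p^*\|)\underline\epsilon(t+1)}\le\eta.$$ -/

import Mathlib

open MeasureTheory ProbabilityTheory

namespace SPDCL

/-- The dual space `ℝᵐ` with its Euclidean structure. -/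
abbrev DualSpace (m : ℕ) : Type := EuclideanSpace ℝ (Fin m)

/-- The `i`-th block space `ℝ^{nᵢ}`. -/
abbrev Block {N : ℕ} (n : Fin N → ℕ) (i : Fin N) : Type := EuclideanSpace ℝ (Fin (n i))

/-- The primal space `ℝ^{n₁} × ⋯ × ℝ^{n_N}` with the Euclidean norm. -/
abbrev PrimalSpace {N : ℕ} (n : Fin N → ℕ) : Type := PiLp 2 (fun i : Fin N => Block n i)

/-- A nearest point of `S` to `x`; for a nonempty closed convex `S` this is the projection onto `S`. -/
noncomputable def metricProj {m : ℕ} (S : Set (DualSpace m)) (x : DualSpace m) : DualSpace m :=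
  Classical.epsilon fun y => y ∈ S ∧ ∀ z ∈ S, ‖x - y‖ ≤ ‖x - z‖

theorem metricProj_spec {m : ℕ} {S : Set (DualSpace m)} (hc : IsClosed S) (hn : S.Nonempty)
    (x : DualSpace m) : metricProj S x ∈ S ∧ ∀ z ∈ S, ‖x - metricProj S x‖ ≤ ‖x - z‖ := by
  have h : ∃ y, y ∈ S ∧ ∀ z ∈ S, ‖x - y‖ ≤ ‖x - z‖ := by
    obtain ⟨y, hy, hd⟩ := hc.exists_infDist_eq_dist hn x
    refine ⟨y, hy, fun z hz => ?_⟩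
    rw [← dist_eq_norm, ← dist_eq_norm, ← hd]
    exact Metric.infDist_le_dist_of_mem hz
  exact Classical.epsilon_spec h

/-- `f` is `C`-convex on `U`: `f (αu + (1-α)v) - αf(u) - (1-α)f(v) ∈ -C`. -/
def CConvexOn {m : ℕ} {X : Type*} [AddCommGroup X] [Module ℝ X] (C : ProperCone ℝ (DualSpace m))
    (U : Set X) (f : X → DualSpace m) : Prop :=
  ∀ u ∈ U, ∀ v ∈ U, ∀ α : ℝ, 0 ≤ α → α ≤ 1 →
    -(f (α • u + (1 - α) • v) - α • f u - (1 - α) • f v) ∈ C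

/-- The data of the problem `min G(u) + J(u)` subject to `Ω(u) + Φ(u) ∈ -C`, `u ∈ U`, with `U`,
`J`, `Φ` decomposed along the blocks, and the data of the algorithm: the (additive) core function,
the constants that enter the step sizes, the penalty parameter and the starting values.
The hypotheses on the data are in `Setting.Assumptions`. -/
structure Setting {N : ℕ} (n : Fin N → ℕ) (m : ℕ) where
  /-- the block constraint sets `Uᵢ` -/
  Ub : (i : Fin N) → Set (Block n i)
  /-- the closed convex cone `C` -/
  C : ProperCone ℝ (DualSpace m)
  /-- the smooth part of the objective -/
  G : PrimalSpace n → ℝ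
  /-- the blocks of the nonsmooth part of the objective -/
  Jb : (i : Fin N) → Block n i → ℝ
  /-- the smooth part of the constraint mapping -/
  Om : PrimalSpace n → DualSpace m
  /-- the blocks of the nonsmooth part of the constraint mapping -/
  Phb : (i : Fin N) → Block n i → DualSpace m
  /-- Lipschitz constant of `∇G` -/
  BG : ℝ
  /-- the element `T` of `C` in the smoothness condition on `Ω` -/
  T : DualSpace m
  /-- Lipschitz constant of `Θ` -/
  tau : ℝ
  /-- the blocks of the core function -/
  Kb : (i : Fin N) → Block n i → ℝ
  /-- strong convexity constant of the core function -/
  beta : ℝ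
  /-- Lipschitz constant of the gradient of the core function -/
  B : ℝ
  /-- penalty parameter -/
  gamma : ℝ
  /-- bound on the dual solutions -/
  mu0 : ℝ
  /-- starting values `u⁰`, `p⁰`, `ε⁻¹` (the last being the step size with index `-1`) -/
  u0 : PrimalSpace n
  p0 : DualSpace m
  epsInit : ℝ

namespace Setting

variable {N : ℕ} {n : Fin N → ℕ} {m : ℕ} (S : Setting n m)

/-- `U = U₁ × ⋯ × U_N`. -/
def U : Set (PrimalSpace n) := {u | ∀ i, u i ∈ S.Ub i}

/-- `J(u) = ∑ᵢ Jᵢ(uᵢ)`. -/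
noncomputable def J (u : PrimalSpace n) : ℝ := ∑ i, S.Jb i (u i)

/-- `Φ(u) = ∑ᵢ Φᵢ(uᵢ)`. -/
noncomputable def Ph (u : PrimalSpace n) : DualSpace m := ∑ i, S.Phb i (u i)

/-- The core function `K(u) = ∑ᵢ Kᵢ(uᵢ)`. -/
noncomputable def K (u : PrimalSpace n) : ℝ := ∑ i, S.Kb i (u i)

/-- The objective `F = G + J`. -/
noncomputable def F (u : PrimalSpace n) : ℝ := S.G u + S.J u

/-- The constraint mapping `Θ = Ω + Φ`. -/
noncomputable def Theta (u : PrimalSpace n) : DualSpace m := S.Om u + S.Ph u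

/-- The conjugate cone `C* = {y | ⟨y, x⟩ ≥ 0 for all x ∈ C}`. -/
noncomputable def Cstar : ProperCone ℝ (DualSpace m) :=
  ProperCone.innerDual (S.C : Set (DualSpace m))

/-- The projection `Π` onto `C*`. -/
noncomputable def Pi (x : DualSpace m) : DualSpace m :=
  metricProj (S.Cstar : Set (DualSpace m)) x

/-- The Bregman-like function `D(u,v) = K(u) - K(v) - ⟨∇K(v), u - v⟩`. -/
noncomputable def D (u v : PrimalSpace n) : ℝ :=
  S.K u - S.K v - inner ℝ (gradient S.K v) (u - v)

/-- The Lagrangian. -/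
noncomputable def L (u : PrimalSpace n) (p : DualSpace m) : ℝ := S.F u + inner ℝ p (S.Theta u)

/-- The augmented Lagrangian `F(u) + [‖Π(p + γΘ(u))‖² - ‖p‖²] / (2γ)`. -/
noncomputable def Lgamma (u : PrimalSpace n) (p : DualSpace m) : ℝ :=
  S.F u + (‖S.Pi (p + S.gamma • S.Theta u)‖ ^ 2 - ‖p‖ ^ 2) / (2 * S.gamma)

/-- `(u*, p*)` is a saddle point of the Lagrangian on `U × C*`. -/
def IsSaddlePoint (us : PrimalSpace n) (ps : DualSpace m) : Prop :=
  us ∈ S.U ∧ ps ∈ S.Cstar ∧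
    ∀ u ∈ S.U, ∀ p ∈ S.Cstar, S.L us p ≤ S.L us ps ∧ S.L us ps ≤ S.L u ps

/-- Hypotheses on the problem, the core function and the parameters. -/
structure Assumptions : Prop where
  Ub_closed : ∀ i, IsClosed (S.Ub i)
  Ub_convex : ∀ i, Convex ℝ (S.Ub i)
  J_convex : ConvexOn ℝ S.U S.J
  J_lsc : LowerSemicontinuousOn S.J S.U
  G_convex : ConvexOn ℝ S.U S.G
  G_diff : ∀ u ∈ S.U, DifferentiableAt ℝ S.G u
  BG_nonneg : 0 ≤ S.BG
  G_lip : ∀ u ∈ S.U, ∀ v ∈ S.U, ‖gradient S.G u - gradient S.G v‖ ≤ S.BG * ‖u - v‖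
  Om_convex : CConvexOn S.C S.U S.Om
  Om_diff : ∀ u ∈ S.U, DifferentiableAt ℝ S.Om u
  T_mem : S.T ∈ S.C
  /-- `⟨∇Ω(u) - ∇Ω(v), u - v⟩ - ‖u - v‖² T ∈ -C` -/
  Om_smooth : ∀ u ∈ S.U, ∀ v ∈ S.U,
    -((fderiv ℝ S.Om u - fderiv ℝ S.Om v) (u - v) - ‖u - v‖ ^ 2 • S.T) ∈ S.C
  Ph_convex : CConvexOn S.C S.U S.Ph
  tau_pos : 0 < S.tau
  Theta_lip : ∀ u ∈ S.U, ∀ v ∈ S.U, ‖S.Theta u - S.Theta v‖ ≤ S.tau * ‖u - v‖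
  beta_pos : 0 < S.beta
  K_strong : StrongConvexOn S.U S.beta S.K
  K_diff : ∀ u ∈ S.U, DifferentiableAt ℝ S.K u
  K_lip : ∀ u ∈ S.U, ∀ v ∈ S.U, ‖gradient S.K u - gradient S.K v‖ ≤ S.B * ‖u - v‖
  gamma_pos : 0 < S.gamma
  u0_mem : S.u0 ∈ S.U
  epsInit_pos : 0 < S.epsInit

/-- `ρ = γ / (2N - 1)`. -/
noncomputable def rho : ℝ := S.gamma / (2 * (N : ℝ) - 1)

/-- `μ = μ₀ + 1`. -/
noncomputable def mu : ℝ := S.mu0 + 1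

/-- `q = Π(p + γΘ(u))`. -/
noncomputable def q (u : PrimalSpace n) (p : DualSpace m) : DualSpace m :=
  S.Pi (p + S.gamma • S.Theta u)

/-- The step size following the step size `e`, at the iterate `(u, p)`:
`min {e, β / (2 (B_G + ‖q‖‖T‖ + γτ²))}`. -/
noncomputable def nextStep (e : ℝ) (u : PrimalSpace n) (p : DualSpace m) : ℝ :=
  min e (S.beta / (2 * (S.BG + ‖S.q u p‖ * ‖S.T‖ + S.gamma * S.tau ^ 2)))

/-- The first step size `ε⁰`. -/
noncomputable def eps0 : ℝ := S.nextStep S.epsInit S.u0 S.p0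

/-- The function of `w` minimised over `U` in the primal step with block `i`, step size `e`,
at the iterate `(u, p)`. -/
noncomputable def subproblem (i : Fin N) (e : ℝ) (u : PrimalSpace n) (p : DualSpace m)
    (w : PrimalSpace n) : ℝ :=
  inner ℝ (gradient S.G u i) (w i) + S.Jb i (w i)
    + inner ℝ (S.q u p) (fderiv ℝ S.Om u (PiLp.single 2 i (w i)) + S.Phb i (w i))
    + 1 / e * S.D w u

/-- The random sequences `u`, `p`, `eps` are generated by the algorithm from the random block
choices `blk`. -/
structure IsRun {W : Type*} (blk : ℕ → W → Fin N) (u : ℕ → W → PrimalSpace n)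
    (p : ℕ → W → DualSpace m) (eps : ℕ → W → ℝ) : Prop where
  u_zero : ∀ ω, u 0 ω = S.u0
  p_zero : ∀ ω, p 0 ω = S.p0
  eps_zero : ∀ ω, eps 0 ω = S.nextStep S.epsInit (u 0 ω) (p 0 ω)
  eps_succ : ∀ k ω, eps (k + 1) ω = S.nextStep (eps k ω) (u (k + 1) ω) (p (k + 1) ω)
  u_succ_mem : ∀ k ω, u (k + 1) ω ∈ S.U
  u_succ_min : ∀ k ω,
    IsMinOn (S.subproblem (blk k ω) (eps k ω) (u k ω) (p k ω)) S.U (u (k + 1) ω)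
  p_succ : ∀ k ω, p (k + 1) ω = metricProj (Metric.closedBall 0 S.mu)
    (p k ω + (S.rho / S.gamma) • (S.Pi (p k ω + S.gamma • S.Theta (u (k + 1) ω)) - p k ω))

/-- `h₃(u, p)` for the saddle point `(u*, p*)`. -/
noncomputable def h3 (us : PrimalSpace n) (ps : DualSpace m) (u : PrimalSpace n)
    (p : DualSpace m) : ℝ :=
  S.D u S.u0 + ((N : ℝ) - 1) / N * S.D us S.u0 + S.eps0 / S.gamma * ‖p - S.p0‖ ^ 2
    + (2 * (N : ℝ) - 1) * ((N : ℝ) - 1) * S.eps0 / (N : ℝ) ^ 2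
      * (‖ps - S.p0‖ ^ 2 / (2 * S.gamma) + S.Lgamma S.u0 S.p0 - S.L us ps)

/-- `d₃ = sup {h₃(u*, p) : ‖p‖ < μ}`. -/
noncomputable def d3 (us : PrimalSpace n) (ps : DualSpace m) : ℝ :=
  sSup (S.h3 us ps us '' Metric.ball 0 S.mu)

/-- `|F(u) - F(u*)| + ‖Π(Θ(u))‖`. -/
noncomputable def gap (us u : PrimalSpace n) : ℝ := |S.F u - S.F us| + ‖S.Pi (S.Theta u)‖

/-- `(μ + 1) N d₃ / ((μ - ‖p*‖) ε̲ (t + 1))`. -/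
noncomputable def rateBound (us : PrimalSpace n) (ps : DualSpace m) (epsLow : ℝ) (t : ℕ) : ℝ :=
  (S.mu + 1) * N * S.d3 us ps / ((S.mu - ‖ps‖) * epsLow * ((t : ℝ) + 1))

/-- `(μ + 1) N d₃ / (ε η ε̲ (μ - ‖p*‖)) - 1`. -/
noncomputable def threshold (us : PrimalSpace n) (ps : DualSpace m) (epsLow ε η : ℝ) : ℝ :=
  (S.mu + 1) * N * S.d3 us ps / (ε * η * epsLow * (S.mu - ‖ps‖)) - 1

end Setting

/-- The weighted average `(∑_{k ≤ t} εᵏ uᵏ⁺¹) / (∑_{k ≤ t} εᵏ)`. -/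
noncomputable def average {N : ℕ} {n : Fin N → ℕ} {W : Type*} (u : ℕ → W → PrimalSpace n)
    (eps : ℕ → W → ℝ) (t : ℕ) (ω : W) : PrimalSpace n :=
  (∑ k ∈ Finset.range (t + 1), eps k ω)⁻¹ • ∑ k ∈ Finset.range (t + 1), eps k ω • u (k + 1) ω

end SPDCL

/-! Each iteration splits into a random primal inequality that does not involve the competing
multiplier and a deterministic dual inequality. Write `augGap` for 2γ(L_γ − F(u*)) and `lagGap` for
2γ(L − F(u*)); recall F(u*) = L(u*, p*).

Primal part (`integral_primal_step`): the proximal inequality for the drawn block, the descent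
estimate allowed by the step size, and convexity averaged over the uniform draw bound the
expectation of ε^k [N augGap(u^{k+1}, p^k) − (N−1) augGap(u^k, p^k) + slack] by 2γN times the
expected decrease of D(u*, ·). A nonnegative weight depending on the past may be inserted.

Dual part (`dual_step_le`, `potential_step`): for a multiplier p^k in the ball, on every path the
same combination, up to a factor 1 + λ, dominates lagGap(u^{k+1}, w) plus the increment of a
nonnegative potential. The choice ρ = γ/(2N−1) makes the terms in the unprojected step match
exactly. Since this is pathwise, w may depend on the whole path, and no supremum has to pass through
an expectation. As the potential is nonnegative and ε^k is nonincreasing, summation by parts leaves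
only its initial value.

The delicate point is the first dual step: p⁰ may lie outside the ball, and then the projection
correction can point along the step. The slack of the primal step and the factor 2N (instead of
2N−1) before ‖w − p⁰‖² pay for it; λ, equal to (N−1)/N or 0, is fixed according to u¹
(`exists_first_potential_le`). In both cases 1 + λ ≤ (2N−1)/N, so the D-terms telescope to the
constant in h₃ (`integral_sum_lagGap_le`, `two_mul_h3`).

Taking w = μ Π(Θ(ū))/‖Π(Θ(ū))‖ turns the Lagrangian gap of the average ū into F(ū) − F(u*) +
μ‖Π(Θ(ū))‖, which controls the wanted quantity by the saddle inequality (`gap_le`). Markov's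
inequality gives the probability bounds. -/

namespace SPDCL

/-! ### First-order inequalities and summation by parts -/

section Analysis

variable {X : Type*} [NormedAddCommGroup X] [InnerProductSpace ℝ X]

/-- The derivative of a function along a line. -/
theorem hasDerivAt_comp_line {f : X → ℝ} {x d : X} {s : ℝ}
    (hf : DifferentiableAt ℝ f (x + s • d)) :
    HasDerivAt (fun r : ℝ => f (x + r • d)) (fderiv ℝ f (x + s • d) d) s := by
  have h1 : HasDerivAt (fun r : ℝ => x + r • d) d s := by
    simpa using ((hasDerivAt_id s).smul_const d).const_add x
  exact hf.hasFDerivAt.comp_hasDerivAt s h1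

/-- If a differentiable function grows at least as fast as `m` along a line, its directional
derivative is at least `m`. -/
theorem le_fderiv_of_forall_le {f : X → ℝ} {x d : X} {m : ℝ} (hf : DifferentiableAt ℝ f x)
    (h : ∀ s : ℝ, 0 < s → s ≤ 1 → s * m ≤ f (x + s • d) - f x) : m ≤ fderiv ℝ f x d := by
  have h0 : HasDerivAt (fun r : ℝ => f (x + r • d)) (fderiv ℝ f x d) 0 := by
    have := hasDerivAt_comp_line (f := f) (x := x) (d := d) (s := 0) (by simpa using hf)
    simpa using this
  have h1 := (hasDerivAt_iff_tendsto_slope_zero.1 h0).mono_left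
    (nhdsWithin_mono (0 : ℝ) (s := Set.Ioi 0) (fun s hs => (ne_of_gt hs : s ≠ 0)))
  refine ge_of_tendsto h1 ?_
  filter_upwards [Ioc_mem_nhdsGT (zero_lt_one' ℝ)] with s hs
  have := h s hs.1 hs.2
  simp only [zero_add, zero_smul, add_zero, smul_eq_mul]
  rw [inv_mul_eq_div, le_div_iff₀ hs.1]
  linarith

/-- First-order inequality for a convex function that is differentiable at `x`. -/
theorem convexOn_fderiv_le {U : Set X} {f : X → ℝ} (hf : ConvexOn ℝ U f) {x y : X} (hx : x ∈ U)
    (hy : y ∈ U) (hd : DifferentiableAt ℝ f x) : fderiv ℝ f x (y - x) ≤ f y - f x := by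
  have h : f x - f y ≤ fderiv ℝ (fun z => -f z) x (y - x) := by
    refine le_fderiv_of_forall_le (f := fun z => -f z) hd.neg fun s hs hs1 => ?_
    have := hf.2 hx hy (sub_nonneg.2 hs1) hs.le (by ring)
    have e : (1 - s) • x + s • y = x + s • (y - x) := by module
    rw [e] at this
    simp only [smul_eq_mul] at this
    linarith
  have e : fderiv ℝ (fun z => -f z) x = -fderiv ℝ f x := fderiv_fun_neg
  rw [e] at h
  simp only [neg_apply] at h
  linarith

/-- Descent inequality for a function with one-sided Lipschitz derivative on a convex set. -/
theorem le_of_fderiv_one_sided_lipschitz {U : Set X} (hU : Convex ℝ U) {f : X → ℝ} {c : ℝ}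
    (hd : ∀ x ∈ U, DifferentiableAt ℝ f x)
    (hc : ∀ x ∈ U, ∀ y ∈ U, (fderiv ℝ f x - fderiv ℝ f y) (x - y) ≤ c * ‖x - y‖ ^ 2)
    {x y : X} (hx : x ∈ U) (hy : y ∈ U) :
    f y ≤ f x + fderiv ℝ f x (y - x) + c / 2 * ‖y - x‖ ^ 2 := by
  -- The claim is g(1) ≤ g(0); the one-sided Lipschitz bound makes g nonincreasing on [0, 1].
  set g : ℝ → ℝ := fun s =>
    f (x + s • (y - x)) - s * fderiv ℝ f x (y - x) - c / 2 * ‖y - x‖ ^ 2 * s ^ 2 with hg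
  have hmem : ∀ s ∈ Set.Icc (0 : ℝ) 1, x + s • (y - x) ∈ U := fun s hs =>
    hU.add_smul_sub_mem hx hy hs
  have hder : ∀ s ∈ Set.Icc (0 : ℝ) 1, HasDerivAt g
      (fderiv ℝ f (x + s • (y - x)) (y - x) - 1 * fderiv ℝ f x (y - x)
        - c / 2 * ‖y - x‖ ^ 2 * (2 * s)) s := by
    intro s hs
    refine ((hasDerivAt_comp_line (hd _ (hmem s hs))).sub
      ((hasDerivAt_id s).mul_const _)).sub ?_
    simpa using ((hasDerivAt_id s).pow 2).const_mul (c / 2 * ‖y - x‖ ^ 2)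
  have hanti : AntitoneOn g (Set.Icc 0 1) := by
    refine antitoneOn_of_deriv_nonpos (convex_Icc 0 1)
      (fun s hs => (hder s hs).continuousAt.continuousWithinAt) ?_ ?_
    · intro s hs
      rw [interior_Icc] at hs
      exact (hder s (Set.Ioo_subset_Icc_self hs)).differentiableAt.differentiableWithinAt
    · intro s hs
      rw [interior_Icc] at hs
      rw [(hder s (Set.Ioo_subset_Icc_self hs)).deriv]
      have h1 := hc _ (hmem s (Set.Ioo_subset_Icc_self hs)) x hx
      have e : x + s • (y - x) - x = s • (y - x) := by abel
      rw [e, map_smul, norm_smul, Real.norm_of_nonneg hs.1.le, smul_eq_mul,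
        sub_apply] at h1
      have h2 : s * (fderiv ℝ f (x + s • (y - x)) (y - x) - fderiv ℝ f x (y - x)
          - c * ‖y - x‖ ^ 2 * s) ≤ 0 := by nlinarith
      have h3 := nonpos_of_mul_nonpos_right h2 hs.1
      linarith
  have h := hanti (Set.left_mem_Icc.2 zero_le_one) (Set.right_mem_Icc.2 zero_le_one) zero_le_one
  simp only [hg] at h
  simp only [one_smul, add_sub_cancel, zero_smul, add_zero, zero_mul] at h
  linarith

/-- First-order inequality for a strongly convex function that is differentiable at `x`. -/
theorem strongConvexOn_fderiv_le {U : Set X} {f : X → ℝ} {β : ℝ} (hf : StrongConvexOn U β f)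
    {x y : X} (hx : x ∈ U) (hy : y ∈ U) (hd : DifferentiableAt ℝ f x) :
    fderiv ℝ f x (y - x) + β / 2 * ‖y - x‖ ^ 2 ≤ f y - f x := by
  -- Centring the subtracted quadratic at x leaves a convex function with the same value and
  -- derivative at x.
  have hconv : ConvexOn ℝ U fun z => f z - β / 2 * ‖z - x‖ ^ 2 := by
    refine ⟨hf.1, fun a ha b hb s r hs hr hsr => ?_⟩
    have h1 := hf.2 ha hb hs hr hsr
    have e : ‖s • a + r • b - x‖ ^ 2
        = s * ‖a - x‖ ^ 2 + r * ‖b - x‖ ^ 2 - s * r * ‖a - b‖ ^ 2 := by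
      obtain rfl : r = 1 - s := by linarith
      have e1 : s • a + (1 - s) • b - x = s • (a - x) + (1 - s) • (b - x) := by module
      have e2 : a - b = (a - x) - (b - x) := by abel
      rw [e1, e2, norm_add_sq_real, norm_sub_sq_real (a - x) (b - x), norm_smul, norm_smul,
        mul_pow, mul_pow,
        real_inner_smul_left, real_inner_smul_right]
      simp only [Real.norm_eq_abs, sq_abs]
      ring
    simp only [smul_eq_mul] at h1 ⊢
    rw [e]
    nlinarith
  have hn : HasFDerivAt (fun z : X => β / 2 * ‖z - x‖ ^ 2) (0 : X →L[ℝ] ℝ) x := by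
    have h1 : HasFDerivAt (fun z : X => z - x) (ContinuousLinearMap.id ℝ X) x :=
      (hasFDerivAt_id x).sub_const x
    have h2 := (h1.norm_sq).const_mul (β / 2)
    exact h2.congr_fderiv (by ext v; simp)
  have h := convexOn_fderiv_le hconv hx hy (hd.sub hn.differentiableAt)
  have e : fderiv ℝ (fun z => f z - β / 2 * ‖z - x‖ ^ 2) x = fderiv ℝ f x := by
    rw [(hd.hasFDerivAt.fun_sub hn).fderiv]
    simp
  rw [e] at h
  simp only [sub_self, norm_zero] at h
  nlinarith

/-- A minimiser of `h + k` with `h` convex satisfies the first-order optimality condition. -/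
theorem IsMinOn.fderiv_optimality {U : Set X} {h k : X → ℝ} (hh : ConvexOn ℝ U h) {a w : X}
    (ha : a ∈ U) (hw : w ∈ U) (hk : DifferentiableAt ℝ k a)
    (hmin : IsMinOn (fun z => h z + k z) U a) : h a - h w ≤ fderiv ℝ k a (w - a) := by
  refine le_fderiv_of_forall_le hk fun s hs hs1 => ?_
  have h1 := hh.2 ha hw (sub_nonneg.2 hs1) hs.le (by ring)
  have e : (1 - s) • a + s • w = a + s • (w - a) := by module
  have h2 := hmin (hh.1 ha hw (sub_nonneg.2 hs1) hs.le (by ring))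
  rw [e] at h1 h2
  simp only [smul_eq_mul, Set.mem_ofPred_eq] at h1 h2
  linarith

/-- Summation by parts with nonincreasing weights and a nonnegative sequence. -/
theorem sum_antitone_mul_sub_ge {e f : ℕ → ℝ} (he : ∀ k, e (k + 1) ≤ e k) (he0 : ∀ k, 0 ≤ e k)
    (hf : ∀ k, 0 ≤ f k) (t : ℕ) :
    -(e 0 * f 0) ≤ ∑ k ∈ Finset.range t, e k * (f (k + 1) - f k) := by
  suffices h : e t * f t - e 0 * f 0 ≤ ∑ k ∈ Finset.range t, e k * (f (k + 1) - f k) by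
    have := mul_nonneg (he0 t) (hf t)
    linarith
  induction t with
  | zero => simp
  | succ t ih =>
    rw [Finset.sum_range_succ]
    have := mul_le_mul_of_nonneg_right (he t) (hf (t + 1))
    linarith

end Analysis

/-! ### Projection onto the dual cone and the augmented term -/

section Projection

variable {m : ℕ}

/-- Variational inequality for the nearest point of a closed convex set. -/
theorem inner_sub_metricProj_le {S : Set (DualSpace m)} (hc : IsClosed S) (hn : S.Nonempty)
    (hS : Convex ℝ S) (x : DualSpace m) {z : DualSpace m} (hz : z ∈ S) :
    inner ℝ (x - metricProj S x) (z - metricProj S x) ≤ 0 := by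
  obtain ⟨h1, h2⟩ := metricProj_spec hc hn x
  refine (norm_eq_iInf_iff_real_inner_le_zero hS h1).1 ?_ z hz
  have : Nonempty S := ⟨⟨_, h1⟩⟩
  refine le_antisymm (le_ciInf fun w => h2 w w.2) ?_
  exact ciInf_le (f := fun w : S => ‖x - w‖) ⟨0, by rintro _ ⟨w, rfl⟩; exact norm_nonneg _⟩
    ⟨_, h1⟩

variable {N : ℕ} {n : Fin N → ℕ} (S : Setting n m)

theorem mem_Cstar_iff {y : DualSpace m} : y ∈ S.Cstar ↔ ∀ x ∈ S.C, 0 ≤ inner ℝ y x := by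
  unfold Setting.Cstar
  rw [ProperCone.mem_innerDual]
  constructor
  · intro h x hx
    rw [real_inner_comm]
    exact h hx
  · intro h x hx
    rw [real_inner_comm]
    exact h x hx

theorem convex_Cstar : Convex ℝ (S.Cstar : Set (DualSpace m)) := fun _ hx _ hy _ _ ha hb _ =>
  S.Cstar.add_mem (S.Cstar.smul_mem hx ha) (S.Cstar.smul_mem hy hb)

theorem Pi_mem (x : DualSpace m) : S.Pi x ∈ S.Cstar :=
  (metricProj_spec S.Cstar.isClosed ⟨0, S.Cstar.zero_mem⟩ x).1

theorem inner_sub_Pi_sub_le (x : DualSpace m) {z : DualSpace m} (hz : z ∈ S.Cstar) :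
    inner ℝ (x - S.Pi x) (z - S.Pi x) ≤ 0 :=
  inner_sub_metricProj_le S.Cstar.isClosed ⟨0, S.Cstar.zero_mem⟩ (convex_Cstar S) x hz

theorem inner_sub_Pi_self (x : DualSpace m) : inner ℝ (x - S.Pi x) (S.Pi x) = 0 := by
  have h0 := inner_sub_Pi_sub_le S x S.Cstar.zero_mem
  -- The test point 2Π(x) gives the inequality opposite to the one from the test point 0.
  have h2 := inner_sub_Pi_sub_le S x (S.Cstar.add_mem (Pi_mem S x) (Pi_mem S x))
  rw [zero_sub, inner_neg_right] at h0
  rw [add_sub_cancel_right] at h2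
  linarith

theorem inner_sub_Pi_le (x : DualSpace m) {z : DualSpace m} (hz : z ∈ S.Cstar) :
    inner ℝ (x - S.Pi x) z ≤ 0 := by
  have h := inner_sub_Pi_sub_le S x hz
  rw [inner_sub_right, inner_sub_Pi_self] at h
  linarith

theorem inner_Pi_self (x : DualSpace m) : inner ℝ (S.Pi x) x = ‖S.Pi x‖ ^ 2 := by
  have h := inner_sub_Pi_self S x
  rw [inner_sub_left, real_inner_self_eq_norm_sq, real_inner_comm] at h
  linarith

/-- The part x − Π(x) lies in the polar of C* and contributes nonpositively, so only Π(x) counts. -/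
theorem inner_le_norm_mul_norm_Pi (x : DualSpace m) {z : DualSpace m} (hz : z ∈ S.Cstar) :
    inner ℝ z x ≤ ‖z‖ * ‖S.Pi x‖ := by
  have h := inner_sub_Pi_le S x hz
  rw [inner_sub_left, real_inner_comm, real_inner_comm z (S.Pi x)] at h
  linarith [real_inner_le_norm z (S.Pi x)]

theorem norm_Pi_sub_Pi_le (x y : DualSpace m) : ‖S.Pi x - S.Pi y‖ ≤ ‖x - y‖ := by
  have h1 := inner_sub_Pi_sub_le S x (Pi_mem S y)
  have h2 := inner_sub_Pi_sub_le S y (Pi_mem S x)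
  have h3 : ‖S.Pi x - S.Pi y‖ ^ 2 ≤ inner ℝ (x - y) (S.Pi x - S.Pi y) := by
    rw [← real_inner_self_eq_norm_sq]
    simp only [inner_sub_left, inner_sub_right] at *
    rw [real_inner_comm (S.Pi x) (S.Pi y)] at *
    linarith
  have h4 := real_inner_le_norm (x - y) (S.Pi x - S.Pi y)
  by_contra! h
  nlinarith [norm_nonneg (x - y), norm_nonneg (S.Pi x - S.Pi y)]

/-- Half the squared norm of the projection has a 1-Lipschitz gradient, the projection. -/
theorem norm_Pi_add_sq_le (x d : DualSpace m) :
    ‖S.Pi (x + d)‖ ^ 2 ≤ ‖S.Pi x‖ ^ 2 + 2 * inner ℝ (S.Pi x) d + ‖d‖ ^ 2 := by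
  have h1 := inner_Pi_self S (x + d)
  have h2 := inner_sub_Pi_le S x (Pi_mem S (x + d))
  have h3 : ‖S.Pi (x + d)‖ ^ 2 ≤ inner ℝ (S.Pi (x + d)) (S.Pi x + d) := by
    rw [real_inner_comm] at h2
    simp only [inner_sub_right, inner_add_right] at *
    linarith
  have h4 := real_inner_le_norm (S.Pi (x + d)) (S.Pi x + d)
  have h5 : ‖S.Pi (x + d)‖ ≤ ‖S.Pi x + d‖ := by
    by_contra! h
    nlinarith [norm_nonneg (S.Pi (x + d)), norm_nonneg (S.Pi x + d)]
  have h6 := norm_add_sq_real (S.Pi x) d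
  nlinarith [norm_nonneg (S.Pi (x + d))]

/-- The augmented term dominates the linear one, with the strong concavity remainder. -/
theorem two_mul_inner_add_le_augmented (p θ : DualSpace m) (γ : ℝ) {w : DualSpace m}
    (hw : w ∈ S.Cstar) :
    2 * γ * inner ℝ w θ + 2 * inner ℝ (p - w) (S.Pi (p + γ • θ) - p)
        + ‖S.Pi (p + γ • θ) - p‖ ^ 2
      ≤ ‖S.Pi (p + γ • θ)‖ ^ 2 - ‖p‖ ^ 2 := by
  have h := inner_sub_Pi_le S (p + γ • θ) hw
  have h2 := norm_sub_sq_real (S.Pi (p + γ • θ)) p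
  set q := S.Pi (p + γ • θ)
  rw [real_inner_comm] at h
  simp only [inner_sub_right, inner_sub_left, inner_add_right, real_inner_smul_right,
    real_inner_self_eq_norm_sq] at *
  rw [real_inner_comm p q] at *
  linarith

theorem augmented_add_norm_sq (p θ : DualSpace m) (γ : ℝ) :
    2 * γ * inner ℝ (S.Pi (p + γ • θ)) θ
      = ‖S.Pi (p + γ • θ)‖ ^ 2 - ‖p‖ ^ 2 + ‖S.Pi (p + γ • θ) - p‖ ^ 2 := by
  have h := inner_Pi_self S (p + γ • θ)
  have h2 := norm_sub_sq_real (S.Pi (p + γ • θ)) p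
  rw [inner_add_right, real_inner_smul_right] at h
  linarith

/-- Concavity of the augmented term in the multiplier. -/
theorem augmented_concave (p p' θ : DualSpace m) (γ : ℝ) :
    ‖S.Pi (p' + γ • θ)‖ ^ 2 - ‖p'‖ ^ 2 ≤ ‖S.Pi (p + γ • θ)‖ ^ 2 - ‖p‖ ^ 2
      + 2 * inner ℝ (p' - p) (S.Pi (p + γ • θ) - p) := by
  have h := norm_Pi_add_sq_le S (p + γ • θ) (p' - p)
  have e : p + γ • θ + (p' - p) = p' + γ • θ := by abel
  rw [e] at h
  have h2 : ‖p'‖ ^ 2 = ‖p‖ ^ 2 + 2 * inner ℝ p (p' - p) + ‖p' - p‖ ^ 2 := by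
    rw [← norm_add_sq_real, add_sub_cancel]
  rw [inner_sub_right, real_inner_comm _ (p' - p), real_inner_comm p (p' - p)]
  linarith

end Projection

/-! ### The projected dual step as inequalities in an inner product space -/

section DualStep

variable {E : Type*} [NormedAddCommGroup E] [InnerProductSpace ℝ E]

/-- If the correction made by the projection onto a ball does not point against the step, then
the starting point is outside the ball. -/
theorem add_norm_le_of_inner_nonneg {μ r : ℝ} (hr : 0 ≤ r) {p y n : E} (hn : n ≠ 0)
    (hμ : 0 ≤ μ)
    (hproj : ∀ w : E, ‖w‖ ≤ μ → 0 ≤ inner ℝ n (w - (p + (r • y + n))))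
    (hny : 0 ≤ inner ℝ n y) : μ + ‖n‖ ≤ ‖p‖ := by
  have hn' : 0 < ‖n‖ := norm_pos_iff.2 hn
  -- The point of the ball furthest in the direction −n gives the sharpest variational inequality.
  have h1 := hproj (-(μ / ‖n‖) • n) (by
    rw [norm_smul, norm_neg, Real.norm_of_nonneg (by positivity), div_mul_cancel₀ _ hn'.ne'])
  have h2 : inner ℝ n (-(μ / ‖n‖) • n) = -(μ * ‖n‖) := by
    rw [real_inner_smul_right, real_inner_self_eq_norm_sq]
    field_simp
  rw [inner_sub_right, h2] at h1
  simp only [inner_add_right, real_inner_smul_right, real_inner_self_eq_norm_sq] at h1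
  have h3 := abs_le.1 (abs_real_inner_le_norm n p)
  have h4 := mul_nonneg hr hny
  nlinarith [h3.1]

/-- Dual step inequality when the correction does not point along the step. -/
theorem dual_step_le {N R r : ℝ} (hN : 1 ≤ N) (hR : R = 2 * N - 1) (hr : r * R = 1)
    {p y n w : E} {A A' l : ℝ} (hny : inner ℝ n y ≤ 0)
    (hproj : 0 ≤ inner ℝ n (w - (p + (r • y + n))))
    (hA : l + 2 * inner ℝ (p - w) y + ‖y‖ ^ 2 ≤ A)
    (hA' : A' ≤ A + 2 * inner ℝ (r • y + n) y) :
    (N - 1) * A' + l + R * (‖p + (r • y + n) - w‖ ^ 2 - ‖p - w‖ ^ 2) ≤ N * A := by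
  have e1 : p + (r • y + n) - w = (p - w) + (r • y + n) := by abel
  have e2 : w - (p + (r • y + n)) = -(p - w) - (r • y + n) := by abel
  rw [e1, norm_add_sq_real (p - w), norm_add_sq_real (r • y), norm_smul, mul_pow]
  rw [e2] at hproj
  generalize p - w = e at *
  simp only [inner_add_right, inner_add_left, real_inner_smul_right, real_inner_smul_left,
    real_inner_self_eq_norm_sq, inner_neg_right, inner_sub_right, Real.norm_eq_abs, sq_abs] at *
  rw [real_inner_comm e n] at *
  rw [real_inner_comm y n] at *
  have h1 := mul_le_mul_of_nonneg_left hA' (sub_nonneg.2 hN)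
  have hRpos : 0 ≤ R := by linarith
  have h2 := mul_nonneg hRpos hproj
  have h3 := mul_nonpos_of_nonneg_of_nonpos (sub_nonneg.2 hN) hny
  have h4 : 0 ≤ R * ‖n‖ ^ 2 := by positivity
  have h5 : R * (2 * (r * inner ℝ e y + inner ℝ e n)
      + (r ^ 2 * ‖y‖ ^ 2 + 2 * (r * inner ℝ y n) + ‖n‖ ^ 2))
      = 2 * inner ℝ e y + 2 * R * inner ℝ e n + r * ‖y‖ ^ 2 + 2 * inner ℝ y n + R * ‖n‖ ^ 2 := by
    linear_combination (2 * inner ℝ e y + r * ‖y‖ ^ 2 + 2 * inner ℝ y n) * hr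
  have h6 : R * (-inner ℝ e n - (r * inner ℝ y n + ‖n‖ ^ 2))
      = - R * inner ℝ e n - inner ℝ y n - R * ‖n‖ ^ 2 := by
    linear_combination (- inner ℝ y n) * hr
  -- Here 2(N−1) = R − 1 and rR = 1: the concavity error and the expanded distance together produce
  -- exactly one ‖y‖², the amount available in `hA`.
  have h7 : 2 * (N - 1) * (r * ‖y‖ ^ 2) = ‖y‖ ^ 2 - r * ‖y‖ ^ 2 := by
    subst hR
    linear_combination ‖y‖ ^ 2 * hr
  nlinarith

/-- Young's inequality absorbs the cross term into R/N a²; the b²-terms then fit because N(2N−1)² −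
(N−1)(3N−1)(N+1) = (N−1)³ + N. The b²-term on the right is what the primal slack supplies. -/
theorem first_step_coefficient {N R : ℝ} (hN : 1 ≤ N) (hR : R = 2 * N - 1) (a b : ℝ) :
    2 * (N - 1) / N * (a * b) + 2 * (N - 1) / R * b ^ 2 ≤ R / N * a ^ 2 + R / (N + 1) * b ^ 2 := by
  have hRpos : 0 < R := by linarith
  have h1 : 2 * (N - 1) / N * (a * b) ≤ R / N * a ^ 2 + (N - 1) ^ 2 / (N * R) * b ^ 2 := by
    have h : 0 ≤ (R * a - (N - 1) * b) ^ 2 / (N * R) := by positivity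
    have e : (R * a - (N - 1) * b) ^ 2 / (N * R) = R / N * a ^ 2 + (N - 1) ^ 2 / (N * R) * b ^ 2
        - 2 * (N - 1) / N * (a * b) := by
      field_simp
      ring
    linarith
  have h2 : (N - 1) ^ 2 / (N * R) + 2 * (N - 1) / R ≤ R / (N + 1) := by
    rw [div_add_div _ _ (by positivity) (by positivity), div_le_div_iff₀ (by positivity)
      (by positivity)]
    have h3 : 0 ≤ R ^ 2 * ((N - 1) ^ 3 + N) := by
      have := pow_nonneg (sub_nonneg.2 hN) 3
      positivity
    subst hR
    nlinarith
  have h4 := mul_le_mul_of_nonneg_right h2 (sq_nonneg b)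
  rw [add_mul] at h4
  linarith

/-- Completing the square gives l ≤ A + (‖p‖+μ)². The distance to w costs at most 4μ², and 4μ² +
4μ‖n‖ + ‖n‖² = (2μ+‖n‖)² ≤ (‖p‖+μ)² because p is at least ‖n‖ outside the ball. The total weight 1 +
R = 2N explains the 2N. -/
theorem first_dual_step_aux {N R r μ Smax : ℝ} (hN : 1 ≤ N) (hR : R = 2 * N - 1)
    {p y n w : E} {A l : ℝ} (hA : l + 2 * inner ℝ (p - w) y + ‖y‖ ^ 2 ≤ A)
    (hw : ‖w‖ ≤ μ) (hp1 : ‖p + (r • y + n)‖ ≤ μ) (hp : μ + ‖n‖ ≤ ‖p‖)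
    (hS : (‖p‖ + μ) ^ 2 ≤ Smax) :
    l + R * ‖p + (r • y + n) - w‖ ^ 2 + R * (4 * μ * ‖n‖ + ‖n‖ ^ 2) ≤ A + 2 * N * Smax := by
  have hRpos : 0 < R := by linarith
  have hμ : 0 ≤ μ := (norm_nonneg w).trans hw
  have hl : l ≤ A + (‖p‖ + μ) ^ 2 := by
    have h1 := norm_add_sq_real (p - w) y
    have h2 : ‖p - w‖ ^ 2 ≤ (‖p‖ + μ) ^ 2 := by
      gcongr
      exact (norm_sub_le _ _).trans (by linarith)
    nlinarith [sq_nonneg ‖p - w + y‖]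
  have hpw : ‖p + (r • y + n) - w‖ ^ 2 ≤ (2 * μ) ^ 2 :=
    pow_le_pow_left₀ (norm_nonneg _) ((norm_sub_le _ _).trans (by linarith)) 2
  have hRpw := mul_le_mul_of_nonneg_left hpw hRpos.le
  have h1 : (2 * μ + ‖n‖) ^ 2 ≤ (‖p‖ + μ) ^ 2 :=
    pow_le_pow_left₀ (by positivity) (by linarith) 2
  have h2 := mul_le_mul_of_nonneg_left h1 hRpos.le
  have h3 := mul_le_mul_of_nonneg_left hS (by positivity : 0 ≤ 2 * N)
  subst hR
  linarith

/-- First dual step from outside the ball, when the next multiplier estimate is close to the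
dual solution `s`. -/
theorem first_dual_step_le_of_near {N R r μ Smax sl : ℝ} (hN : 1 ≤ N) (hR : R = 2 * N - 1)
    (hr : r * R = 1) {p y n w s : E} {A A' l : ℝ}
    (hA : l + 2 * inner ℝ (p - w) y + ‖y‖ ^ 2 ≤ A)
    (hAs : 2 * inner ℝ (p - s) y + ‖y‖ ^ 2 ≤ A)
    (hA' : A' ≤ A + 2 * inner ℝ (r • y + n) y)
    (hw : ‖w‖ ≤ μ) (hp1 : ‖p + (r • y + n)‖ ≤ μ) (hp : μ + ‖n‖ ≤ ‖p‖)
    (hS : (‖p‖ + μ) ^ 2 ≤ Smax) (hsl : N / (N + 1) * ‖y‖ ^ 2 ≤ sl)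
    (hQ : ‖p + y - s‖ ≤ 2 * μ) :
    l + R * ‖p + (r • y + n) - w‖ ^ 2
        + R * (N - 1) / N * (A' + ‖p + (r • y + n) - s‖ ^ 2)
      ≤ R * A + R / N * sl + 2 * N * Smax + R * (N - 1) / N * ‖p - s‖ ^ 2 := by
  have hN0 : 0 < N := by linarith
  have hRpos : 0 < R := by linarith
  have hμ : 0 ≤ μ := (norm_nonneg w).trans hw
  have haux := first_dual_step_aux hN hR hA hw hp1 hp hS
  obtain ⟨t, ht⟩ : ∃ t, t = (N - 1) / N := ⟨_, rfl⟩
  have htN : N * t = N - 1 := by rw [ht]; field_simp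
  have ht0 : 0 ≤ t := by rw [ht]; exact div_nonneg (by linarith) hN0.le
  have ht1 : 0 ≤ 1 - t := by rw [ht, sub_nonneg, div_le_one hN0]; linarith
  have hκ : R * (N - 1) / N = R * t := by rw [ht]; ring
  have hRt : R - 1 - R * t = t := by linear_combination hR * (1 - t) - 2 * htN
  have hsl' : R / (N + 1) * ‖y‖ ^ 2 ≤ R / N * sl := by
    calc _ = R / N * (N / (N + 1) * ‖y‖ ^ 2) := by field_simp
      _ ≤ _ := by gcongr
  have hcoef := first_step_coefficient hN hR ‖n‖ ‖y‖
  have hcoef1 : 2 * (N - 1) / N = 2 * t := by rw [ht]; ring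
  have hcoef2 : 2 * (N - 1) / R = t * (1 + r) := by
    rw [div_eq_iff hRpos.ne']
    linear_combination (-t) * hr - t * hR - 2 * htN
  have hcoef3 : R / N = R * (1 - t) := by rw [ht]; field_simp; ring
  rw [hcoef1, hcoef2, hcoef3] at hcoef
  -- The only use of nearness: it bounds the contribution of n by the 4μ‖n‖ that
  -- `first_dual_step_aux` leaves over.
  have hnQ : inner ℝ n (p + y - s) ≤ ‖n‖ * (2 * μ) :=
    (real_inner_le_norm _ _).trans (by gcongr)
  have hny := real_inner_le_norm n y
  have e1 : p + (r • y + n) - s = (p - s) + (r • y + n) := by abel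
  have e2 : p + y - s = (p - s) + y := by abel
  have e3 : ‖p + (r • y + n) - s‖ ^ 2 = ‖p - s‖ ^ 2
      + 2 * (r * inner ℝ (p - s) y + inner ℝ (p - s) n)
      + (r ^ 2 * ‖y‖ ^ 2 + 2 * (r * inner ℝ n y) + ‖n‖ ^ 2) := by
    rw [e1, norm_add_sq_real (p - s), norm_add_sq_real (r • y), norm_smul, mul_pow,
      Real.norm_eq_abs, sq_abs, inner_add_right, real_inner_smul_right, real_inner_smul_left,
      real_inner_comm y n]
  rw [e2, inner_add_right, real_inner_comm (p - s) n] at hnQ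
  rw [inner_add_left, real_inner_smul_left, real_inner_self_eq_norm_sq] at hA'
  rw [hκ, e3]
  clear hA hS hsl hQ hp hp1 hw hκ hcoef1 hcoef2 hcoef3 e1 e2 e3
  generalize ‖p + (r • y + n) - w‖ = a1 at *
  generalize inner ℝ n y = ny at *
  generalize inner ℝ (p - s) n = fn at *
  generalize inner ℝ (p - s) y = fy at *
  generalize ‖p - s‖ = nf at *
  have hn0 : 0 ≤ ‖n‖ := norm_nonneg n
  generalize ‖n‖ = nn at *
  generalize ‖y‖ = yy at *
  have h1 := mul_le_mul_of_nonneg_left hA' (mul_nonneg hRpos.le ht0)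
  have h2 := mul_le_mul_of_nonneg_left hAs ht0
  have h3 := mul_le_mul_of_nonneg_left hnQ (mul_nonneg hRpos.le ht0)
  have h4 := mul_le_mul_of_nonneg_left hny ht0
  have h5 : R * t * (2 * (r * yy ^ 2 + ny)) + R * t * (2 * (r * fy + fn)
      + (r ^ 2 * yy ^ 2 + 2 * (r * ny) + nn ^ 2))
      = 2 * t * yy ^ 2 + 2 * t * fy + t * r * yy ^ 2 + 2 * t * ny
        + R * t * (2 * (fn + ny) + nn ^ 2) := by
    linear_combination (2 * t * yy ^ 2 + 2 * t * fy + t * r * yy ^ 2 + 2 * t * ny) * hr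
  have h6 : 0 ≤ (1 - t) * (4 * μ * nn) * R := by positivity
  have h7 : A + R * t * A + t * A = R * A := by linear_combination (-A) * hRt
  linarith

/-- First dual step from outside the ball, when the next multiplier estimate is far from the
dual solution `s`. -/
theorem first_dual_step_le_of_far {N R r μ Smax sl : ℝ} (hN : 1 ≤ N) (hR : R = 2 * N - 1)
    (hr : r * R = 1) {p y n w s : E} {A A' l : ℝ}
    (hA : l + 2 * inner ℝ (p - w) y + ‖y‖ ^ 2 ≤ A)
    (hAs : 2 * inner ℝ (p - s) y + ‖y‖ ^ 2 ≤ A)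
    (hA' : A' ≤ A + 2 * inner ℝ (r • y + n) y)
    (hw : ‖w‖ ≤ μ) (hp1 : ‖p + (r • y + n)‖ ≤ μ) (hp : μ + ‖n‖ ≤ ‖p‖)
    (hS : (‖p‖ + μ) ^ 2 ≤ Smax) (hsl : N / (N + 1) * ‖y‖ ^ 2 ≤ sl)
    (hQ : 2 * μ ≤ ‖p + y - s‖) :
    l + R * ‖p + (r • y + n) - w‖ ^ 2 + (N - 1) * (A' + 4 * μ ^ 2)
      ≤ R * A + R / N * sl + 2 * N * Smax + R * (N - 1) / N * ‖p - s‖ ^ 2 := by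
  have hN0 : 0 < N := by linarith
  have hN1 : 0 ≤ N - 1 := by linarith
  have hRpos : 0 < R := by linarith
  have hμ : 0 ≤ μ := (norm_nonneg w).trans hw
  have haux := first_dual_step_aux hN hR hA hw hp1 hp hS
  obtain ⟨t, ht⟩ : ∃ t, t = (N - 1) / N := ⟨_, rfl⟩
  have htN : N * t = N - 1 := by rw [ht]; field_simp
  have hκ : R * (N - 1) / N = R * t := by rw [ht]; ring
  have hsl' : R / (N + 1) * ‖y‖ ^ 2 ≤ R / N * sl := by
    calc _ = R / N * (N / (N + 1) * ‖y‖ ^ 2) := by field_simp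
      _ ≤ _ := by gcongr
  have hcoef : 2 * (N - 1) * r * ‖y‖ ^ 2 ≤ R / (N + 1) * ‖y‖ ^ 2 := by
    have h := first_step_coefficient hN hR 0 ‖y‖
    have e : 2 * (N - 1) / R = 2 * (N - 1) * r := by
      rw [div_eq_iff hRpos.ne']
      linear_combination (-2 * (N - 1)) * hr
    rw [e] at h
    simpa using h
  -- The only use of farness: if ‖n‖ ≤ 2μ, squaring is monotone in ‖p + y − s‖ − ‖n‖ ≥ 2μ − ‖n‖;
  -- otherwise 4μ‖n‖ already exceeds 4μ².
  have hμQ : 0 ≤ (‖p + y - s‖ - ‖n‖) ^ 2 - 4 * μ ^ 2 + 4 * μ * ‖n‖ := by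
    rcases le_total (‖n‖) (2 * μ) with h | h
    · have : (2 * μ - ‖n‖) ^ 2 ≤ (‖p + y - s‖ - ‖n‖) ^ 2 :=
        pow_le_pow_left₀ (by linarith) (by linarith) 2
      nlinarith [sq_nonneg (‖n‖)]
    · nlinarith [sq_nonneg (‖p + y - s‖ - ‖n‖)]
  have hnQ := real_inner_le_norm n (p + y - s)
  have hnf := (abs_le.1 (abs_real_inner_le_norm n (p - s))).1
  have e2 : p + y - s = (p - s) + y := by abel
  have hQ2 := norm_add_sq_real (p - s) y
  rw [e2] at hnQ hμQ
  rw [inner_add_right] at hnQ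
  rw [inner_add_left, real_inner_smul_left, real_inner_self_eq_norm_sq] at hA'
  rw [hκ]
  clear hA hS hsl hQ hp hp1 hw hκ e2
  have hn0 : 0 ≤ ‖n‖ := norm_nonneg n
  generalize ‖p + (r • y + n) - w‖ = a1 at *
  generalize inner ℝ n y = ny at *
  generalize inner ℝ n (p - s) = fn at *
  generalize inner ℝ (p - s) y = fy at *
  generalize ‖p - s + y‖ = nQ at *
  generalize ‖p - s‖ = nf at *
  generalize ‖n‖ = nn at *
  generalize ‖y‖ = yy at *
  have h1 := mul_le_mul_of_nonneg_left hA' hN1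
  have h2 := mul_le_mul_of_nonneg_left hAs hN1
  have h3 := mul_le_mul_of_nonneg_left hnQ hN1
  have h4 := mul_le_mul_of_nonneg_left hnf hN1
  have h5 := mul_nonneg hN1 hμQ
  -- Young's inequality with weights chosen so that the ‖p − s‖² terms add up to the coefficient
  -- (N−1) + (N−1)t = Rt in the goal.
  have h6 : 2 * (N - 1) * (nn * nf) ≤ N * nn ^ 2 + (N - 1) * t * nf ^ 2 := by
    have h : 0 ≤ N * (nn - t * nf) ^ 2 := by positivity
    have e : N * (nn - t * nf) ^ 2 = N * nn ^ 2 + (N - 1) * t * nf ^ 2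
        - 2 * (N - 1) * (nn * nf) := by
      linear_combination (t * nf ^ 2 - 2 * (nn * nf)) * htN
    linarith
  have h8 : R * t = (N - 1) + (N - 1) * t := by
    subst hR
    linear_combination htN
  have h10 : 0 ≤ N * (μ * nn) := by positivity
  have h11 : (N - 1) * nQ ^ 2 = (N - 1) * (nf ^ 2 + 2 * fy + yy ^ 2) := by rw [hQ2]
  rw [h8]
  subst hR
  linarith

end DualStep

/-! ### Block structure and the primal proximal step -/

section PrimalStep

variable {N m : ℕ} {n : Fin N → ℕ} (S : Setting n m)

theorem fderiv_apply_eq_inner_gradient {X : Type*} [NormedAddCommGroup X] [InnerProductSpace ℝ X]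
    [CompleteSpace X] (f : X → ℝ) (x v : X) : fderiv ℝ f x v = inner ℝ (gradient f x) v := by
  rw [← toDual_gradient, InnerProductSpace.toDual_apply_apply]

/-- Replace the `i`-th block of `x` by that of `w`. -/
noncomputable def blockSwap (i : Fin N) (x w : PrimalSpace n) : PrimalSpace n :=
  WithLp.toLp 2 (Function.update x.ofLp i (w i))

@[simp] theorem blockSwap_same (i : Fin N) (x w : PrimalSpace n) : blockSwap i x w i = w i := by
  simp [blockSwap]

theorem blockSwap_of_ne {i j : Fin N} (h : j ≠ i) (x w : PrimalSpace n) :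
    blockSwap i x w j = x j := by
  simp [blockSwap, h]

variable {S}

theorem blockSwap_mem (i : Fin N) {x w : PrimalSpace n} (hx : x ∈ S.U) (hw : w ∈ S.U) :
    blockSwap i x w ∈ S.U := by
  intro j
  by_cases h : j = i
  · subst h
    rw [blockSwap_same]
    exact hw j
  · rw [blockSwap_of_ne h]
    exact hx j

theorem sum_blockSwap {E : Type*} [AddCommGroup E] (f : (i : Fin N) → Block n i → E) (i : Fin N)
    (x w : PrimalSpace n) :
    ∑ j, f j (blockSwap i x w j) = ∑ j, f j (x j) + (f i (w i) - f i (x i)) := by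
  rw [← sub_eq_iff_eq_add', ← Finset.sum_sub_distrib, Finset.sum_eq_single i]
  · rw [blockSwap_same]
  · intro j _ hj
    rw [blockSwap_of_ne hj, sub_self]
  · simp

theorem blockSwap_combo (i : Fin N) (x w w' : PrimalSpace n) {a b : ℝ} (hab : a + b = 1) :
    blockSwap i x (a • w + b • w') = a • blockSwap i x w + b • blockSwap i x w' := by
  ext1 j
  by_cases h : j = i
  · subst h
    simp
  · simp only [PiLp.add_apply, PiLp.smul_apply, blockSwap_of_ne h]
    rw [← add_smul, hab, one_smul]

theorem blockSwap_add_blockSwap (i : Fin N) (x w : PrimalSpace n) :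
    blockSwap i x w + blockSwap i w x = x + w := by
  ext1 j
  by_cases h : j = i
  · subst h
    simp [add_comm]
  · simp [blockSwap_of_ne h]

theorem sum_single (w : PrimalSpace n) : ∑ i, PiLp.single 2 i (w i) = w := by
  ext1 j
  rw [WithLp.ofLp_sum, Finset.sum_apply, Finset.sum_eq_single j]
  · simp
  · intro i _ hi
    rw [PiLp.single_eq_of_ne 2 hi.symm]
  · simp

namespace Setting.Assumptions

variable (hS : S.Assumptions)
include hS

theorem convex_U : Convex ℝ S.U := hS.G_convex.1

theorem convexOn_inner {f : PrimalSpace n → DualSpace m} (hf : CConvexOn S.C S.U f)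
    {q : DualSpace m} (hq : q ∈ S.Cstar) : ConvexOn ℝ S.U fun u => inner ℝ q (f u) := by
  refine ⟨hS.convex_U, fun u hu v hv a b ha hb hab => ?_⟩
  obtain rfl : b = 1 - a := by linarith
  have h := (mem_Cstar_iff S).1 hq _ (hf u hu v hv a ha (by linarith))
  simp only [inner_neg_right, inner_sub_right, real_inner_smul_right] at h
  simp only [smul_eq_mul]
  linarith

end Setting.Assumptions

/-- The derivative at `x` of `G + ⟨q, Ω⟩`. -/
noncomputable def smoothDeriv (S : Setting n m) (x : PrimalSpace n) (q : DualSpace m) :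
    PrimalSpace n →L[ℝ] ℝ :=
  fderiv ℝ S.G x + (innerSL ℝ q).comp (fderiv ℝ S.Om x)

/-- The part of the block subproblem that is not the proximal term. -/
noncomputable def blockModel (S : Setting n m) (i : Fin N) (x : PrimalSpace n) (q : DualSpace m)
    (w : PrimalSpace n) : ℝ :=
  smoothDeriv S x q (PiLp.single 2 i (w i)) + S.Jb i (w i) + inner ℝ q (S.Phb i (w i))

theorem inner_block_eq (x : PrimalSpace n) (i : Fin N) (v : Block n i) :
    inner ℝ (x i) v = inner ℝ x (PiLp.single 2 i v) := by
  rw [PiLp.inner_apply x (PiLp.single 2 i v), Finset.sum_eq_single i]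
  · simp
  · intro j _ hj
    rw [PiLp.single_eq_of_ne 2 hj, inner_zero_right]
  · simp

theorem subproblem_eq (i : Fin N) (e : ℝ) (x : PrimalSpace n) (p : DualSpace m)
    (w : PrimalSpace n) :
    S.subproblem i e x p w = blockModel S i x (S.q x p) w + 1 / e * S.D w x := by
  unfold Setting.subproblem blockModel smoothDeriv
  rw [inner_block_eq, ← fderiv_apply_eq_inner_gradient, inner_add_right]
  simp only [add_apply, ContinuousLinearMap.comp_apply, innerSL_apply_apply]
  ring

theorem blockModel_congr {i : Fin N} {x w w' : PrimalSpace n} {q : DualSpace m}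
    (h : w i = w' i) : blockModel S i x q w = blockModel S i x q w' := by
  unfold blockModel
  rw [h]

theorem sum_blockModel (x : PrimalSpace n) (q : DualSpace m) (w : PrimalSpace n) :
    ∑ i, blockModel S i x q w = smoothDeriv S x q w + S.J w + inner ℝ q (S.Ph w) := by
  unfold blockModel
  rw [Finset.sum_add_distrib, Finset.sum_add_distrib, ← map_sum, sum_single, ← inner_sum]
  rfl

theorem inner_Theta (q : DualSpace m) (u : PrimalSpace n) :
    inner ℝ q (S.Theta u) = inner ℝ q (S.Om u) + inner ℝ q (S.Ph u) := by
  rw [Setting.Theta, inner_add_right]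

theorem K_blockSwap (i : Fin N) (x w : PrimalSpace n) :
    S.K (blockSwap i x w) + S.K (blockSwap i w x) = S.K x + S.K w := by
  simp only [Setting.K, sum_blockSwap]
  ring

theorem D_three_point (w a x : PrimalSpace n) :
    S.D w x = S.D w a + S.D a x + (fderiv ℝ S.K a (w - a) - fderiv ℝ S.K x (w - a)) := by
  unfold Setting.D
  rw [fderiv_apply_eq_inner_gradient, fderiv_apply_eq_inner_gradient]
  have e : w - x = (w - a) + (a - x) := by abel
  rw [e, inner_add_right]
  ring

namespace Setting.Assumptions

variable (hS : S.Assumptions)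
include hS

/-- Convexity of J and Φ is assumed only for the sums on U. Freezing all blocks but the i-th at
those of a point x of U transfers it to the single block. -/
theorem convexOn_blockModel (i : Fin N) {x : PrimalSpace n} (hx : x ∈ S.U) {q : DualSpace m}
    (hq : q ∈ S.Cstar) : ConvexOn ℝ S.U (blockModel S i x q) := by
  refine ⟨hS.convex_U, fun w hw w' hw' a b ha hb hab => ?_⟩
  have hJ := hS.J_convex.2 (blockSwap_mem i hx hw) (blockSwap_mem i hx hw') ha hb hab
  have hP := (hS.convexOn_inner hS.Ph_convex hq).2 (blockSwap_mem i hx hw)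
    (blockSwap_mem i hx hw') ha hb hab
  rw [← blockSwap_combo i x w w' hab] at hJ hP
  simp only [Setting.J, Setting.Ph, sum_blockSwap, smul_eq_mul, inner_add_right,
    inner_sub_right] at hJ hP
  have hl : smoothDeriv S x q (PiLp.single 2 i ((a • w + b • w') i))
      = a * smoothDeriv S x q (PiLp.single 2 i (w i))
        + b * smoothDeriv S x q (PiLp.single 2 i (w' i)) := by
    have e : PiLp.single 2 i ((a • w + b • w') i)
        = a • PiLp.single 2 i (w i) + b • PiLp.single 2 i (w' i) := by
      ext1 j
      by_cases h : j = i
      · subst h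
        simp
      · simp [h]
    rw [e, map_add, map_smul, map_smul, smul_eq_mul, smul_eq_mul]
  unfold blockModel
  rw [hl]
  simp only [smul_eq_mul]
  obtain rfl : b = 1 - a := by linarith
  linarith

theorem D_ge {u v : PrimalSpace n} (hu : u ∈ S.U) (hv : v ∈ S.U) :
    S.beta / 2 * ‖u - v‖ ^ 2 ≤ S.D u v := by
  have h := strongConvexOn_fderiv_le hS.K_strong hv hu (hS.K_diff v hv)
  unfold Setting.D
  rw [← fderiv_apply_eq_inner_gradient]
  linarith

theorem D_nonneg {u v : PrimalSpace n} (hu : u ∈ S.U) (hv : v ∈ S.U) : 0 ≤ S.D u v :=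
  le_trans (mul_nonneg (by linarith [hS.beta_pos]) (sq_nonneg _)) (hS.D_ge hu hv)

theorem eq_of_D_nonpos {u v : PrimalSpace n} (hu : u ∈ S.U) (hv : v ∈ S.U)
    (h : S.D u v ≤ 0) : u = v := by
  have h1 := (hS.D_ge hu hv).trans h
  have h2 := hS.beta_pos
  have h3 : ‖u - v‖ ^ 2 ≤ 0 := by
    by_contra! h3
    nlinarith
  rwa [sq_nonpos_iff, norm_eq_zero, sub_eq_zero] at h3

/-- Quadratic-type growth of the subproblem away from its minimiser. -/
theorem subproblem_growth {i : Fin N} {e : ℝ} {x a w : PrimalSpace n} {p : DualSpace m}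
    (hx : x ∈ S.U) (ha : a ∈ S.U) (hw : w ∈ S.U)
    (hmin : IsMinOn (S.subproblem i e x p) S.U a) :
    S.subproblem i e x p a + 1 / e * S.D w a ≤ S.subproblem i e x p w := by
  have hd : HasFDerivAt (fun z => 1 / e * S.D z x)
      ((1 / e) • (fderiv ℝ S.K a - fderiv ℝ S.K x)) a := by
    have h1 := (hS.K_diff a ha).hasFDerivAt
    have h2 : HasFDerivAt (fun z => S.D z x) (fderiv ℝ S.K a - fderiv ℝ S.K x) a := by
      have h3 : HasFDerivAt (fun z : PrimalSpace n => fderiv ℝ S.K x (z - x)) (fderiv ℝ S.K x) a :=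
        (fderiv ℝ S.K x).hasFDerivAt.comp a ((hasFDerivAt_id a).sub_const x)
      have h4 := (h1.sub_const (S.K x)).fun_sub h3
      refine h4.congr_of_eventuallyEq (Filter.Eventually.of_forall fun z => ?_)
      simp only [Setting.D, fderiv_apply_eq_inner_gradient]
    exact h2.const_mul _
  have hmin' : IsMinOn (fun z => blockModel S i x (S.q x p) z + 1 / e * S.D z x) S.U a := by
    simpa only [← subproblem_eq] using hmin
  have h := IsMinOn.fderiv_optimality (hS.convexOn_blockModel (q := S.q x p) i hx (Pi_mem S _))
    ha hw
    hd.differentiableAt hmin'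
  rw [hd.fderiv] at h
  simp only [smul_apply, sub_apply, smul_eq_mul] at h
  rw [subproblem_eq, subproblem_eq, D_three_point w a x]
  linarith

/-- The minimiser of the subproblem is unique. -/
theorem subproblem_argmin_unique {i : Fin N} {e : ℝ} (he : 0 < e) {x a w : PrimalSpace n}
    {p : DualSpace m} (hx : x ∈ S.U) (ha : a ∈ S.U) (hw : w ∈ S.U)
    (hmin : IsMinOn (S.subproblem i e x p) S.U a)
    (hmin' : IsMinOn (S.subproblem i e x p) S.U w) : w = a := by
  refine hS.eq_of_D_nonpos hw ha ?_
  have h1 := hS.subproblem_growth hx ha hw hmin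
  have h2 : S.subproblem i e x p w ≤ S.subproblem i e x p a := hmin' ha
  have h3 : 1 / e * S.D w a ≤ 0 := by linarith
  by_contra! h
  have : 0 < 1 / e * S.D w a := by positivity
  linarith

/-- The primal step only changes the selected block. -/
theorem eq_blockSwap_of_isMinOn {i : Fin N} {e : ℝ} (he : 0 < e) {x a : PrimalSpace n}
    {p : DualSpace m} (hx : x ∈ S.U) (ha : a ∈ S.U)
    (hmin : IsMinOn (S.subproblem i e x p) S.U a) : a = blockSwap i x a := by
  -- Restoring the other blocks to those of x keeps the model value, so it cannot decrease D. As K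
  -- is additive, D(a, x) is the sum of the part in block i and the part in the other blocks, and
  -- the latter must vanish.
  have h1 : S.subproblem i e x p a ≤ S.subproblem i e x p (blockSwap i x a) :=
    hmin (blockSwap_mem i hx ha)
  rw [subproblem_eq, subproblem_eq, blockModel_congr (blockSwap_same i x a).symm,
    add_le_add_iff_left, mul_le_mul_iff_right₀ (by positivity)] at h1
  have h2 : S.D a x = S.D (blockSwap i x a) x + S.D (blockSwap i a x) x := by
    unfold Setting.D
    have e1 : a - x = (blockSwap i x a - x) + (blockSwap i a x - x) := by
      have := blockSwap_add_blockSwap i x a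
      rw [← sub_eq_zero] at this ⊢
      rw [← neg_eq_zero, ← this]
      abel
    rw [e1, inner_add_right]
    linarith [K_blockSwap (S := S) i x a]
  have h3 := hS.eq_of_D_nonpos (blockSwap_mem i ha hx) hx (by linarith)
  have h4 := blockSwap_add_blockSwap i x a
  rw [h3, add_comm] at h4
  exact (add_left_cancel h4).symm

/-- Off the `i`-th block, the derivative of the additive core function does not depend on that
block. -/
theorem fderiv_K_eq {i : Fin N} {x a v : PrimalSpace n} (hx : x ∈ S.U) (ha : a ∈ S.U)
    (hax : a = blockSwap i x a) (hv : v i = 0) : fderiv ℝ S.K a v = fderiv ℝ S.K x v := by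
  have h1 := hasDerivAt_comp_line (f := S.K) (x := a) (d := v) (s := 0)
    (by simpa using hS.K_diff a ha)
  have h2 := hasDerivAt_comp_line (f := S.K) (x := x) (d := v) (s := 0)
    (by simpa using hS.K_diff x hx)
  rw [zero_smul, add_zero] at h1 h2
  have h3 : (fun r : ℝ => S.K (a + r • v))
      = fun r => S.K (x + r • v) + (S.Kb i (a i) - S.Kb i (x i)) := by
    funext r
    have e : a + r • v = blockSwap i (x + r • v) a := by
      ext1 j
      by_cases h : j = i
      · subst h
        simp [hv]
      · rw [blockSwap_of_ne h, PiLp.add_apply, PiLp.add_apply]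
        conv_lhs => rw [hax, blockSwap_of_ne h]
    rw [e, Setting.K, sum_blockSwap, Setting.K, PiLp.add_apply, PiLp.smul_apply, hv, smul_zero,
      add_zero]
  rw [h3] at h1
  exact h1.unique (h2.add_const _)

/-- Proximal inequality for the block step, against an arbitrary point of `U`. -/
theorem prox_inequality {i : Fin N} {e : ℝ} (he : 0 < e) {x a w : PrimalSpace n}
    {p : DualSpace m} (hx : x ∈ S.U) (ha : a ∈ S.U) (hw : w ∈ S.U)
    (hmin : IsMinOn (S.subproblem i e x p) S.U a) :
    e * (blockModel S i x (S.q x p) a - blockModel S i x (S.q x p) w)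
      ≤ S.D w x - S.D w a - S.D a x := by
  have hax := hS.eq_blockSwap_of_isMinOn he hx ha hmin
  have h := hS.subproblem_growth hx ha (blockSwap_mem i hx hw) hmin
  rw [subproblem_eq, subproblem_eq, blockModel_congr (blockSwap_same i x w)] at h
  have h1 := D_three_point (S := S) (blockSwap i x w) a x
  have h2 := D_three_point (S := S) w a x
  -- Growth is known only against w with its other blocks replaced by those of x. The replaced
  -- directions see the same derivative of K at a and at x, so the three-point difference is
  -- unchanged.
  have h3 := hS.fderiv_K_eq hx ha hax (v := w - blockSwap i x w) (by simp)
  have e1 : w - a = (blockSwap i x w - a) + (w - blockSwap i x w) := by abel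
  rw [e1, map_add, map_add, h3] at h2
  have h4 : blockModel S i x (S.q x p) a - blockModel S i x (S.q x p) w
      ≤ 1 / e * (S.D (blockSwap i x w) x - S.D (blockSwap i x w) a - S.D a x) := by linarith
  have h5 := mul_le_mul_of_nonneg_left h4 he.le
  rw [← mul_assoc, mul_one_div_cancel he.ne', one_mul] at h5
  linarith

theorem differentiableAt_smooth {x : PrimalSpace n} (hx : x ∈ S.U) (q : DualSpace m) :
    HasFDerivAt (fun u => S.G u + inner ℝ q (S.Om u)) (smoothDeriv S x q) x :=
  (hS.G_diff x hx).hasFDerivAt.add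
    ((innerSL ℝ q).hasFDerivAt.comp x (hS.Om_diff x hx).hasFDerivAt)

/-- Pairing the condition on ∇Ω with q ∈ C* and ⟨q, T⟩ ≤ ‖q‖‖T‖ makes B_G + ‖q‖‖T‖ a one-sided
Lipschitz constant for the derivative of G + ⟨q, Ω⟩. -/
theorem smooth_descent {x y : PrimalSpace n} (hx : x ∈ S.U) (hy : y ∈ S.U) {q : DualSpace m}
    (hq : q ∈ S.Cstar) :
    S.G y + inner ℝ q (S.Om y) ≤ S.G x + inner ℝ q (S.Om x) + smoothDeriv S x q (y - x)
      + (S.BG + ‖q‖ * ‖S.T‖) / 2 * ‖y - x‖ ^ 2 := by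
  rw [← (hS.differentiableAt_smooth hx q).fderiv]
  refine le_of_fderiv_one_sided_lipschitz hS.convex_U
    (f := fun u => S.G u + inner ℝ q (S.Om u))
    (fun u hu => (hS.differentiableAt_smooth hu q).differentiableAt) ?_ hx hy
  intro u hu v hv
  rw [(hS.differentiableAt_smooth hu q).fderiv, (hS.differentiableAt_smooth hv q).fderiv]
  have h1 : (fderiv ℝ S.G u - fderiv ℝ S.G v) (u - v) ≤ S.BG * ‖u - v‖ ^ 2 := by
    rw [sub_apply, fderiv_apply_eq_inner_gradient,
      fderiv_apply_eq_inner_gradient, ← inner_sub_left]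
    refine (real_inner_le_norm _ _).trans ?_
    have := mul_le_mul_of_nonneg_right (hS.G_lip u hu v hv) (norm_nonneg (u - v))
    linarith
  have h2 := (mem_Cstar_iff S).1 hq _ (hS.Om_smooth u hu v hv)
  rw [inner_neg_right, inner_sub_right, real_inner_smul_right] at h2
  have h3 := mul_le_mul_of_nonneg_left (real_inner_le_norm q S.T) (sq_nonneg ‖u - v‖)
  have e : (smoothDeriv S u q - smoothDeriv S v q) (u - v)
      = (fderiv ℝ S.G u - fderiv ℝ S.G v) (u - v)
        + inner ℝ q ((fderiv ℝ S.Om u - fderiv ℝ S.Om v) (u - v)) := by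
    simp only [smoothDeriv, sub_apply, add_apply, ContinuousLinearMap.comp_apply,
      innerSL_apply_apply, inner_sub_right]
    ring
  rw [e]
  linarith

theorem smooth_convex {x y : PrimalSpace n} (hx : x ∈ S.U) (hy : y ∈ S.U) {q : DualSpace m}
    (hq : q ∈ S.Cstar) :
    smoothDeriv S x q (y - x) ≤ S.G y + inner ℝ q (S.Om y) - (S.G x + inner ℝ q (S.Om x)) := by
  rw [← (hS.differentiableAt_smooth hx q).fderiv]
  exact convexOn_fderiv_le (hS.G_convex.add (hS.convexOn_inner hS.Om_convex hq)) hx hy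
    (hS.differentiableAt_smooth hx q).differentiableAt

end Setting.Assumptions

/-- `2γ (L_γ(u, p) - F(u*))`. -/
noncomputable def augGap (S : Setting n m) (us u : PrimalSpace n) (p : DualSpace m) : ℝ :=
  2 * S.gamma * (S.F u - S.F us) + (‖S.q u p‖ ^ 2 - ‖p‖ ^ 2)

/-- `2γ (L(u, π) - F(u*))`. -/
noncomputable def lagGap (S : Setting n m) (us u : PrimalSpace n) (w : DualSpace m) : ℝ :=
  2 * S.gamma * (S.L u w - S.F us)

namespace Setting.Assumptions

variable (hS : S.Assumptions)
include hS

theorem norm_q_sub_q_le {x a : PrimalSpace n} (hx : x ∈ S.U) (ha : a ∈ S.U) (p : DualSpace m) :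
    ‖S.q a p - S.q x p‖ ^ 2 ≤ S.gamma ^ 2 * S.tau ^ 2 * ‖a - x‖ ^ 2
      ∧ ‖S.gamma • (S.Theta a - S.Theta x)‖ ^ 2 ≤ S.gamma ^ 2 * S.tau ^ 2 * ‖a - x‖ ^ 2 := by
  have h1 : ‖S.gamma • (S.Theta a - S.Theta x)‖ ≤ S.gamma * (S.tau * ‖a - x‖) := by
    rw [norm_smul, Real.norm_of_nonneg hS.gamma_pos.le]
    exact mul_le_mul_of_nonneg_left (hS.Theta_lip a ha x hx) hS.gamma_pos.le
  have h2 : ‖S.q a p - S.q x p‖ ≤ ‖S.gamma • (S.Theta a - S.Theta x)‖ := by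
    refine (norm_Pi_sub_Pi_le S _ _).trans (le_of_eq ?_)
    congr 1
    module
  have e : S.gamma ^ 2 * S.tau ^ 2 * ‖a - x‖ ^ 2 = (S.gamma * (S.tau * ‖a - x‖)) ^ 2 := by ring
  rw [e]
  exact ⟨pow_le_pow_left₀ (norm_nonneg _) (h2.trans h1) 2,
    pow_le_pow_left₀ (norm_nonneg _) h1 2⟩

/-- One primal step, before taking expectations over the selected block. -/
theorem primal_step {us : PrimalSpace n} (hus : us ∈ S.U) {i : Fin N} {e : ℝ} (he : 0 < e)
    {x a : PrimalSpace n} {p : DualSpace m} (hx : x ∈ S.U) (ha : a ∈ S.U)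
    (hstep : e ≤ S.beta / (2 * (S.BG + ‖S.q x p‖ * ‖S.T‖ + S.gamma * S.tau ^ 2)))
    (hmin : IsMinOn (S.subproblem i e x p) S.U a) :
    e * (augGap S us a p - augGap S us x p + ‖S.q a p - S.q x p‖ ^ 2
        + 2 * S.gamma * (blockModel S i x (S.q x p) x - blockModel S i x (S.q x p) us))
      ≤ 2 * S.gamma * (S.D us x - S.D us a) := by
  have hprox := hS.prox_inequality he hx ha hus hmin
  have hax := hS.eq_blockSwap_of_isMinOn he hx ha hmin
  have hq : S.q x p ∈ S.Cstar := Pi_mem S _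
  have hdesc := hS.smooth_descent hx ha hq
  have hγ := hS.gamma_pos
  obtain ⟨hg1, hg2⟩ := hS.norm_q_sub_q_le hx ha p
  have hphi := norm_Pi_add_sq_le S (p + S.gamma • S.Theta x) (S.gamma • (S.Theta a - S.Theta x))
  have e1 : p + S.gamma • S.Theta x + S.gamma • (S.Theta a - S.Theta x)
      = p + S.gamma • S.Theta a := by module
  rw [e1, real_inner_smul_right, inner_sub_right] at hphi
  change ‖S.q a p‖ ^ 2 ≤ ‖S.q x p‖ ^ 2 + 2 * (S.gamma * (inner ℝ (S.q x p) (S.Theta a)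
    - inner ℝ (S.q x p) (S.Theta x))) + _ at hphi
  rw [inner_Theta, inner_Theta] at hphi
  have hmodel : blockModel S i x (S.q x p) a - blockModel S i x (S.q x p) x
      = smoothDeriv S x (S.q x p) (a - x) + (S.J a - S.J x)
        + (inner ℝ (S.q x p) (S.Ph a) - inner ℝ (S.q x p) (S.Ph x)) := by
    have hs : a - x = PiLp.single 2 i (a i) - PiLp.single 2 i (x i) := by
      ext1 j
      by_cases h : j = i
      · subst h
        simp
      · rw [PiLp.sub_apply, PiLp.sub_apply, PiLp.single_eq_of_ne 2 h, PiLp.single_eq_of_ne 2 h, hax,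
          blockSwap_of_ne h, sub_self, sub_self]
    have hJ : S.J a = S.J x + (S.Jb i (a i) - S.Jb i (x i)) := by
      conv_lhs => rw [hax]
      exact sum_blockSwap S.Jb i x a
    have hP : S.Ph a = S.Ph x + (S.Phb i (a i) - S.Phb i (x i)) := by
      conv_lhs => rw [hax]
      exact sum_blockSwap S.Phb i x a
    rw [hs, map_sub, hJ, hP, inner_add_right, inner_sub_right]
    unfold blockModel
    ring
  have hD := hS.D_ge ha hx
  set c := S.BG + ‖S.q x p‖ * ‖S.T‖ + S.gamma * S.tau ^ 2 with hc
  have hcpos : 0 < c := by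
    have h1 := hS.BG_nonneg
    have h2 : 0 < S.gamma * S.tau ^ 2 := mul_pos hγ (pow_pos hS.tau_pos 2)
    have h3 : 0 ≤ ‖S.q x p‖ * ‖S.T‖ := by positivity
    linarith
  have hec : e * c ≤ S.beta / 2 := by
    rw [le_div_iff₀ (by positivity)] at hstep
    linarith
  -- D pays for the full c‖a − x‖², twice what the descent inequality needs. The surplus covers the
  -- quadratic remainder of the augmented term and keeps ‖q(a) − q(x)‖² on the left as slack.
  have hDc : e * (c * ‖a - x‖ ^ 2) ≤ S.D a x := by
    refine le_trans ?_ hD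
    rw [← mul_assoc]
    gcongr
  have hg3 : S.gamma ^ 2 * S.tau ^ 2 * ‖a - x‖ ^ 2 ≤ S.gamma * (c * ‖a - x‖ ^ 2) := by
    have : S.gamma * S.tau ^ 2 ≤ c := by
      have h1 := hS.BG_nonneg
      have h3 : 0 ≤ ‖S.q x p‖ * ‖S.T‖ := by positivity
      linarith
    calc _ = S.gamma * (S.gamma * S.tau ^ 2 * ‖a - x‖ ^ 2) := by ring
      _ ≤ _ := by gcongr
  have hF : augGap S us a p - augGap S us x p + ‖S.q a p - S.q x p‖ ^ 2
      ≤ 2 * S.gamma * (blockModel S i x (S.q x p) a - blockModel S i x (S.q x p) x)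
        + 2 * S.gamma * (c * ‖a - x‖ ^ 2) := by
    have hd2 := mul_le_mul_of_nonneg_left hdesc (by positivity : 0 ≤ 2 * S.gamma)
    have e2 : 2 * S.gamma * ((S.BG + ‖S.q x p‖ * ‖S.T‖) / 2 * ‖a - x‖ ^ 2)
        = S.gamma * (c * ‖a - x‖ ^ 2) - S.gamma ^ 2 * S.tau ^ 2 * ‖a - x‖ ^ 2 := by
      rw [hc]
      ring
    rw [hmodel]
    unfold augGap Setting.F
    linarith
  have h1 := mul_le_mul_of_nonneg_left hF he.le
  have h2 := mul_le_mul_of_nonneg_left hprox (by positivity : 0 ≤ 2 * S.gamma)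
  have h3 := mul_le_mul_of_nonneg_left hDc (by positivity : 0 ≤ 2 * S.gamma)
  linarith

/-- Convexity, summed over the blocks. -/
theorem le_sum_blockModel {us x : PrimalSpace n} (hus : us ∈ S.U) (hx : x ∈ S.U)
    (p : DualSpace m) (hfeas : inner ℝ (S.q x p) (S.Theta us) ≤ 0) :
    augGap S us x p + ‖S.q x p - p‖ ^ 2 ≤ ∑ i, 2 * S.gamma * (blockModel S i x (S.q x p) x
      - blockModel S i x (S.q x p) us) := by
  have hq : S.q x p ∈ S.Cstar := Pi_mem S _
  have h1 := hS.smooth_convex hx hus hq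
  have h2 : 2 * S.gamma * inner ℝ (S.q x p) (S.Theta x)
      = ‖S.q x p‖ ^ 2 - ‖p‖ ^ 2 + ‖S.q x p - p‖ ^ 2 := augmented_add_norm_sq S p (S.Theta x) S.gamma
  rw [← Finset.mul_sum, Finset.sum_sub_distrib, sum_blockModel, sum_blockModel]
  have h3 : S.F x - S.F us + inner ℝ (S.q x p) (S.Theta x) ≤
      smoothDeriv S x (S.q x p) x + S.J x + inner ℝ (S.q x p) (S.Ph x)
      - (smoothDeriv S x (S.q x p) us + S.J us + inner ℝ (S.q x p) (S.Ph us)) := by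
    rw [map_sub] at h1
    rw [inner_Theta] at hfeas ⊢
    unfold Setting.F
    linarith
  have h4 := mul_le_mul_of_nonneg_left h3 (by linarith [hS.gamma_pos] : 0 ≤ 2 * S.gamma)
  unfold augGap
  linarith

end Setting.Assumptions

end PrimalStep

/-! ### Dependence on finitely many draws, and averaging over a fresh one -/

section History

variable {W : Type*} {N : ℕ}

/-- The function `f` depends on `ω` only through the first `k` block choices. -/
def DeterminedBy {E : Type*} (blk : ℕ → W → Fin N) (k : ℕ) (f : W → E) : Prop :=
  ∀ ω ω', (∀ j < k, blk j ω = blk j ω') → f ω = f ω'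

theorem DeterminedBy.mono {E : Type*} {blk : ℕ → W → Fin N} {k l : ℕ} (hkl : k ≤ l) {f : W → E}
    (hf : DeterminedBy blk k f) : DeterminedBy blk l f :=
  fun ω ω' h => hf ω ω' fun j hj => h j (hj.trans_le hkl)

/-- Factoring through a finite discrete space makes measurability and integrability automatic; no
regularity of the problem data in ω is needed. -/
theorem DeterminedBy.exists_eq_comp {blk : ℕ → W → Fin N} {k : ℕ} {f : W → ℝ}
    (hf : DeterminedBy blk k f) :
    ∃ g : (↥(Finset.range k) → Fin N) → ℝ, f = fun ω => g fun j => blk j ω := by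
  refine ⟨Function.extend (fun ω (j : ↥(Finset.range k)) => blk j ω) f 0, ?_⟩
  funext ω
  refine (Function.FactorsThrough.extend_apply ?_ _ ω).symm
  intro ω ω' h
  exact hf ω ω' fun j hj => congrFun h ⟨j, Finset.mem_range.2 hj⟩

variable [MeasurableSpace W] {P : Measure W} [IsProbabilityMeasure P] {blk : ℕ → W → Fin N}
  (hblk : ∀ k, Measurable (blk k))

include hblk in
theorem DeterminedBy.measurable {k : ℕ} {f : W → ℝ} (hf : DeterminedBy blk k f) :
    Measurable f := by
  obtain ⟨g, rfl⟩ := hf.exists_eq_comp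
  exact (Measurable.of_discrete (f := g)).comp (measurable_pi_lambda _ fun j => hblk j)

include hblk in
theorem DeterminedBy.integrable {k : ℕ} {f : W → ℝ} (hf : DeterminedBy blk k f) :
    Integrable f P := by
  obtain ⟨g, rfl⟩ := hf.exists_eq_comp
  have hm : Measurable fun ω (j : ↥(Finset.range k)) => blk j ω :=
    measurable_pi_lambda _ fun j => hblk j
  have := Measure.isProbabilityMeasure_map (μ := P) hm.aemeasurable
  exact (Integrable.of_finite (f := g)).comp_measurable hm

include hblk in
/-- Averaging over a fresh uniform block choice. -/
theorem integral_fresh_choice (hindep : iIndepFun blk P)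
    (hunif : ∀ k j, P.real {ω | blk k ω = j} = 1 / (N : ℝ)) {k : ℕ} {f : Fin N → W → ℝ}
    (hf : ∀ j, DeterminedBy blk k (f j)) :
    ∫ ω, f (blk k ω) ω ∂P = 1 / (N : ℝ) * ∑ j, ∫ ω, f j ω ∂P := by
  have hmeas : ∀ j, MeasurableSet {ω | blk k ω = j} := fun j =>
    hblk k (MeasurableSet.singleton j)
  have h1 : ∀ ω, f (blk k ω) ω = ∑ j, ({ω | blk k ω = j}.indicator (fun _ => (1 : ℝ)) ω) * f j ω := by
    intro ω
    rw [Finset.sum_eq_single (blk k ω)]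
    · simp
    · intro j _ hj
      simp [hj.symm]
    · simp
  have hprod : ∀ j, ∫ ω, ({ω | blk k ω = j}.indicator (fun _ => (1 : ℝ)) ω) * f j ω ∂P
      = 1 / (N : ℝ) * ∫ ω, f j ω ∂P := by
    intro j
    -- One factor is a function of the k-th draw and the other of the tuple of earlier draws, which
    -- are independent.
    have hi : IndepFun ({ω | blk k ω = j}.indicator (fun _ => (1 : ℝ))) (f j) P := by
      obtain ⟨g, hg⟩ := (hf j).exists_eq_comp
      have h := (hindep.indepFun_finset {k} (Finset.range k) (by simp) hblk).comp
        (φ := fun v : (↥({k} : Finset ℕ) → Fin N) =>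
          if v ⟨k, Finset.mem_singleton_self k⟩ = j then (1 : ℝ) else 0) (ψ := g)
        Measurable.of_discrete Measurable.of_discrete
      rw [hg]
      convert h using 1
      · funext ω
        simp [Set.indicator]
      · rfl
    rw [hi.integral_fun_mul_eq_mul_integral
      (measurable_const.indicator (hmeas j)).aestronglyMeasurable
      ((hf j).measurable hblk).aestronglyMeasurable, integral_indicator (hmeas j)]
    simp [hunif k j]
  have hint : ∀ j, Integrable
      (fun ω => ({ω | blk k ω = j}.indicator (fun _ => (1 : ℝ)) ω) * f j ω) P := by
    intro j
    refine DeterminedBy.integrable (k := k + 1) hblk fun ω ω' h => ?_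
    rw [hf j ω ω' fun i hi => h i (hi.trans (Nat.lt_succ_self k))]
    simp [Set.indicator, h k (Nat.lt_succ_self k)]
  simp_rw [h1]
  rw [integral_finsetSum _ fun j _ => hint j, Finset.mul_sum]
  exact Finset.sum_congr rfl fun j _ => hprod j

end History

/-! ### The iterates as functions of the draws; the primal step in expectation -/

section Run

variable {N m : ℕ} {n : Fin N → ℕ} {S : Setting n m} {W : Type*} {blk : ℕ → W → Fin N}
  {u : ℕ → W → PrimalSpace n} {p : ℕ → W → DualSpace m} {eps : ℕ → W → ℝ}

theorem nextStep_pos (hS : S.Assumptions) {e : ℝ} (he : 0 < e) (x : PrimalSpace n)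
    (y : DualSpace m) : 0 < S.nextStep e x y := by
  have h1 := hS.BG_nonneg
  have h2 := mul_pos hS.gamma_pos (pow_pos hS.tau_pos 2)
  have h3 : 0 ≤ ‖S.q x y‖ * ‖S.T‖ := by positivity
  exact lt_min he (div_pos hS.beta_pos (by linarith))

namespace Setting.IsRun

variable (hS : S.Assumptions) (hrun : S.IsRun blk u p eps)
include hrun

theorem eps_succ_le (k : ℕ) (ω : W) : eps (k + 1) ω ≤ eps k ω := by
  rw [hrun.eps_succ]
  exact min_le_left _ _

theorem eps_le (k : ℕ) (ω : W) : eps k ω ≤ S.beta / (2 * (S.BG + ‖S.q (u k ω) (p k ω)‖ * ‖S.T‖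
    + S.gamma * S.tau ^ 2)) := by
  cases k with
  | zero =>
    rw [hrun.eps_zero]
    exact min_le_right _ _
  | succ k =>
    rw [hrun.eps_succ]
    exact min_le_right _ _

theorem eps_zero_eq (ω : W) : eps 0 ω = S.eps0 := by
  rw [hrun.eps_zero, hrun.u_zero, hrun.p_zero, Setting.eps0]

include hS

theorem eps_pos (k : ℕ) (ω : W) : 0 < eps k ω := by
  induction k with
  | zero =>
    rw [hrun.eps_zero]
    exact nextStep_pos hS hS.epsInit_pos _ _
  | succ k ih =>
    rw [hrun.eps_succ]
    exact nextStep_pos hS ih _ _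

theorem u_mem (k : ℕ) (ω : W) : u k ω ∈ S.U := by
  cases k with
  | zero =>
    rw [hrun.u_zero]
    exact hS.u0_mem
  | succ k => exact hrun.u_succ_mem k ω

/-- The subproblem has a unique minimiser, so the recursion leaves no choice beyond the drawn block.
-/
theorem determined (k : ℕ) : DeterminedBy blk k (fun ω => (u k ω, p k ω, eps k ω)) := by
  induction k with
  | zero =>
    intro ω ω' _
    simp only [hrun.eps_zero, hrun.u_zero, hrun.p_zero]
  | succ k ih =>
    intro ω ω' h
    have h1 := ih ω ω' fun j hj => h j (hj.trans (Nat.lt_succ_self k))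
    simp only [Prod.mk.injEq] at h1
    obtain ⟨hu, hp, he⟩ := h1
    have hmin := hrun.u_succ_min k ω
    have hmin' := hrun.u_succ_min k ω'
    rw [hu, hp, he, h k (Nat.lt_succ_self k)] at hmin
    have hu' : u (k + 1) ω = u (k + 1) ω' :=
      hS.subproblem_argmin_unique (hrun.eps_pos hS k ω') (hrun.u_mem hS k ω')
        (hrun.u_succ_mem k ω') (hrun.u_succ_mem k ω) hmin' hmin
    have hp' : p (k + 1) ω = p (k + 1) ω' := by rw [hrun.p_succ, hrun.p_succ, hp, hu']
    simp only [hrun.eps_succ k, hu', hp', he]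

theorem determined_u {k l : ℕ} (hkl : k ≤ l) : DeterminedBy blk l (u k) := fun ω ω' h =>
  congrArg Prod.fst ((hrun.determined hS k).mono hkl ω ω' h)

theorem determined_p {k l : ℕ} (hkl : k ≤ l) : DeterminedBy blk l (p k) := fun ω ω' h =>
  congrArg (fun z => z.2.1) ((hrun.determined hS k).mono hkl ω ω' h)

theorem determined_eps {k l : ℕ} (hkl : k ≤ l) : DeterminedBy blk l (eps k) := fun ω ω' h =>
  congrArg (fun z => z.2.2) ((hrun.determined hS k).mono hkl ω ω' h)

end Setting.IsRun

/-- The slack term of the primal step. -/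
noncomputable def slack (S : Setting n m) (x a : PrimalSpace n) (y : DualSpace m) : ℝ :=
  ‖S.q x y - y‖ ^ 2 + N * ‖S.q a y - S.q x y‖ ^ 2

variable [MeasurableSpace W] {P : Measure W} [IsProbabilityMeasure P]

/-- One primal step in expectation, with a nonnegative weight that depends on the past only. -/
theorem integral_primal_step (hS : S.Assumptions) (hrun : S.IsRun blk u p eps)
    (hblk : ∀ k, Measurable (blk k)) (hindep : iIndepFun blk P)
    (hunif : ∀ k j, P.real {ω | blk k ω = j} = 1 / (N : ℝ))
    {us : PrimalSpace n} (hus : us ∈ S.U) (hfeas : ∀ q ∈ S.Cstar, inner ℝ q (S.Theta us) ≤ 0)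
    (hN : 0 < N) (k : ℕ) {w : W → ℝ} (hw : DeterminedBy blk k w) (hw0 : ∀ ω, 0 ≤ w ω) :
    ∫ ω, w ω * eps k ω * (N * augGap S us (u (k + 1) ω) (p k ω)
        - (N - 1) * augGap S us (u k ω) (p k ω) + slack S (u k ω) (u (k + 1) ω) (p k ω)) ∂P
      ≤ 2 * S.gamma * N * ∫ ω, w ω * (S.D us (u k ω) - S.D us (u (k + 1) ω)) ∂P := by
  have hN' : (0 : ℝ) < N := Nat.cast_pos.2 hN
  set f : Fin N → W → ℝ := fun j ω => w ω * eps k ω * (2 * S.gamma *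
    (blockModel S j (u k ω) (S.q (u k ω) (p k ω)) (u k ω)
      - blockModel S j (u k ω) (S.q (u k ω) (p k ω)) us)) with hf
  have hfd : ∀ j, DeterminedBy blk k (f j) := by
    intro j ω ω' h
    simp only [hf, hw ω ω' h, hrun.determined_u hS le_rfl ω ω' h,
      hrun.determined_p hS le_rfl ω ω' h, hrun.determined_eps hS le_rfl ω ω' h]
  have hweps : ∀ ω, 0 ≤ w ω * eps k ω := fun ω => mul_nonneg (hw0 ω) (hrun.eps_pos hS k ω).le
  set A : W → ℝ := fun ω => w ω * eps k ω * (augGap S us (u (k + 1) ω) (p k ω)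
    - augGap S us (u k ω) (p k ω)
    + ‖S.q (u (k + 1) ω) (p k ω) - S.q (u k ω) (p k ω)‖ ^ 2) with hA
  set B : W → ℝ := fun ω => w ω * eps k ω * (augGap S us (u k ω) (p k ω)
    + ‖S.q (u k ω) (p k ω) - p k ω‖ ^ 2) with hB
  set R : W → ℝ := fun ω => w ω * (S.D us (u k ω) - S.D us (u (k + 1) ω)) with hR
  have hAint : Integrable A P := by
    refine DeterminedBy.integrable (k := k + 1) hblk fun ω ω' h => ?_
    simp only [hA, hw.mono k.le_succ ω ω' h, hrun.determined_u hS k.le_succ ω ω' h,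
      hrun.determined_u hS le_rfl ω ω' h,
      hrun.determined_p hS k.le_succ ω ω' h, hrun.determined_eps hS k.le_succ ω ω' h]
  have hBint : Integrable B P := by
    refine DeterminedBy.integrable (k := k + 1) hblk fun ω ω' h => ?_
    simp only [hB, hw.mono k.le_succ ω ω' h, hrun.determined_u hS k.le_succ ω ω' h,
      hrun.determined_p hS k.le_succ ω ω' h, hrun.determined_eps hS k.le_succ ω ω' h]
  have hRint : Integrable R P := by
    refine DeterminedBy.integrable (k := k + 1) hblk fun ω ω' h => ?_
    simp only [hR, hw.mono k.le_succ ω ω' h, hrun.determined_u hS k.le_succ ω ω' h,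
      hrun.determined_u hS le_rfl ω ω' h]
  have hfint : Integrable (fun ω => f (blk k ω) ω) P := by
    refine DeterminedBy.integrable (k := k + 1) hblk fun ω ω' h => ?_
    simp only [h k k.lt_succ_self]
    exact (hfd _).mono k.le_succ ω ω' h
  have h1 : ∫ ω, A ω ∂P + ∫ ω, f (blk k ω) ω ∂P ≤ 2 * S.gamma * ∫ ω, R ω ∂P := by
    rw [← integral_add hAint hfint, ← integral_const_mul]
    refine integral_mono (hAint.add hfint) (hRint.const_mul _) fun ω => ?_
    have h := mul_le_mul_of_nonneg_left (hS.primal_step hus (hrun.eps_pos hS k ω)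
      (hrun.u_mem hS k ω) (hrun.u_succ_mem k ω) (hrun.eps_le k ω) (hrun.u_succ_min k ω)) (hw0 ω)
    simp only [hA, hf, hR]
    linarith
  -- Averaging over the fresh draw replaces N times the drawn block's difference by the sum over all
  -- blocks, which convexity bounds below.
  have h2 : ∫ ω, B ω ∂P ≤ N * ∫ ω, f (blk k ω) ω ∂P := by
    rw [integral_fresh_choice hblk hindep hunif hfd, ← mul_assoc, mul_one_div_cancel hN'.ne',
      one_mul, ← integral_finsetSum _ fun j _ => (hfd j).integrable hblk]
    refine integral_mono hBint (integrable_finsetSum _ fun j _ => (hfd j).integrable hblk)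
      fun ω => ?_
    simp only [hB, hf]
    rw [← Finset.mul_sum]
    exact mul_le_mul_of_nonneg_left
      (hS.le_sum_blockModel hus (hrun.u_mem hS k ω) _ (hfeas _ (Pi_mem S _))) (hweps ω)
  have h3 : ∀ ω, w ω * eps k ω * (N * augGap S us (u (k + 1) ω) (p k ω)
      - (N - 1) * augGap S us (u k ω) (p k ω) + slack S (u k ω) (u (k + 1) ω) (p k ω))
      = N * A ω + B ω := by
    intro ω
    simp only [hA, hB, slack]
    ring
  simp_rw [h3]
  rw [integral_add (hAint.const_mul _) hBint, integral_const_mul]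
  have h4 := mul_le_mul_of_nonneg_left h1 hN'.le
  linarith

end Run

/-! ### The dual potential and its increments -/

section DualAnalysis

variable {N m : ℕ} {n : Fin N → ℕ} {S : Setting n m} {us : PrimalSpace n} {ps : DualSpace m}

/-- Testing the saddle inequality in p against 0 and 2p* gives complementary slackness; a general q
then gives the sign. -/
theorem inner_Theta_nonpos_of_saddle (h : S.IsSaddlePoint us ps) :
    (∀ q ∈ S.Cstar, inner ℝ q (S.Theta us) ≤ 0) ∧ inner ℝ ps (S.Theta us) = 0 := by
  obtain ⟨hus, hps, hs⟩ := h
  have h0 := (hs us hus 0 S.Cstar.zero_mem).1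
  have h2 := (hs us hus (ps + ps) (S.Cstar.add_mem hps hps)).1
  unfold Setting.L at h0 h2
  rw [inner_zero_left] at h0
  rw [inner_add_left] at h2
  refine ⟨fun q hq => ?_, by linarith⟩
  have h3 := (hs us hus q hq).1
  unfold Setting.L at h3
  linarith

theorem L_saddle (h : S.IsSaddlePoint us ps) : S.L us ps = S.F us := by
  rw [Setting.L, (inner_Theta_nonpos_of_saddle h).2, add_zero]

theorem lagGap_saddle_nonneg (hS : S.Assumptions) (h : S.IsSaddlePoint us ps)
    {x : PrimalSpace n} (hx : x ∈ S.U) : 0 ≤ lagGap S us x ps := by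
  have h1 := (h.2.2 x hx ps h.2.1).2
  rw [L_saddle h] at h1
  exact mul_nonneg (by linarith [hS.gamma_pos]) (sub_nonneg.2 h1)

theorem augGap_ge (x : PrimalSpace n) (p : DualSpace m) {w : DualSpace m} (hw : w ∈ S.Cstar) :
    lagGap S us x w + 2 * inner ℝ (p - w) (S.q x p - p) + ‖S.q x p - p‖ ^ 2
      ≤ augGap S us x p := by
  have h := two_mul_inner_add_le_augmented S p (S.Theta x) S.gamma hw
  unfold lagGap augGap Setting.L Setting.q
  linarith

theorem augGap_concave (x : PrimalSpace n) (p d : DualSpace m) :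
    augGap S us x (p + d) ≤ augGap S us x p + 2 * inner ℝ d (S.q x p - p) := by
  have h := augmented_concave S p (p + d) (S.Theta x) S.gamma
  rw [add_sub_cancel_left] at h
  unfold augGap Setting.q
  linarith

/-- Using the multiplier p* in `augGap_ge`, the saddle inequality leaves 2⟨p − p*, q − p⟩ + ‖q −
p‖², which is a square minus ‖p − p*‖². -/
theorem augGap_add_nonneg (hS : S.Assumptions) (h : S.IsSaddlePoint us ps)
    {x : PrimalSpace n} (hx : x ∈ S.U) (p : DualSpace m) :
    0 ≤ augGap S us x p + ‖p - ps‖ ^ 2 := by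
  have h1 := augGap_ge (us := us) x p h.2.1
  have h2 := lagGap_saddle_nonneg hS h hx
  have h3 := norm_add_sq_real (p - ps) (S.q x p - p)
  nlinarith [sq_nonneg ‖p - ps + (S.q x p - p)‖]

/-- The dual update. -/
noncomputable def dualUpdate (S : Setting n m) (a : PrimalSpace n) (p : DualSpace m) :
    DualSpace m :=
  metricProj (Metric.closedBall 0 S.mu) (p + (S.rho / S.gamma) • (S.q a p - p))

theorem norm_dualUpdate_le (hμ : 0 ≤ S.mu) (a : PrimalSpace n) (p : DualSpace m) :
    ‖dualUpdate S a p‖ ≤ S.mu := by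
  have h := (metricProj_spec (S := Metric.closedBall (0 : DualSpace m) S.mu)
    Metric.isClosed_closedBall (Metric.nonempty_closedBall.2 hμ)
    (p + (S.rho / S.gamma) • (S.q a p - p))).1
  exact mem_closedBall_zero_iff.1 h

/-- Isolates the correction v made by the projection onto the ball and its variational inequality,
the form in which the abstract dual-step lemmas take the update. -/
theorem exists_dualUpdate_eq (hμ : 0 ≤ S.mu) (a : PrimalSpace n) (p : DualSpace m) :
    ∃ v : DualSpace m, dualUpdate S a p = p + ((S.rho / S.gamma) • (S.q a p - p) + v) ∧
      ∀ w : DualSpace m, ‖w‖ ≤ S.mu →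
        0 ≤ inner ℝ v (w - (p + ((S.rho / S.gamma) • (S.q a p - p) + v))) := by
  refine ⟨dualUpdate S a p - (p + (S.rho / S.gamma) • (S.q a p - p)), by abel, fun w hw => ?_⟩
  have h := inner_sub_metricProj_le (S := Metric.closedBall (0 : DualSpace m) S.mu)
    Metric.isClosed_closedBall (Metric.nonempty_closedBall.2 hμ) (convex_closedBall _ _)
    (p + (S.rho / S.gamma) • (S.q a p - p)) (z := w) (by simpa using hw)
  change inner ℝ (_ - dualUpdate S a p) (w - dualUpdate S a p) ≤ 0 at h
  have e : p + ((S.rho / S.gamma) • (S.q a p - p) + (dualUpdate S a p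
      - (p + (S.rho / S.gamma) • (S.q a p - p)))) = dualUpdate S a p := by abel
  rw [e, ← neg_sub, inner_neg_left]
  linarith

theorem rho_div_gamma_mul (hS : S.Assumptions) (hN : 1 ≤ (N : ℝ)) :
    S.rho / S.gamma * (2 * (N : ℝ) - 1) = 1 := by
  have h1 := hS.gamma_pos
  have h2 : (0 : ℝ) < 2 * N - 1 := by linarith
  unfold Setting.rho
  field_simp

/-- The potential whose increments control the dual part of the iteration. -/
noncomputable def potential (S : Setting n m) (us : PrimalSpace n) (ps w : DualSpace m) (lam : ℝ)
    (x : PrimalSpace n) (p : DualSpace m) : ℝ :=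
  (2 * (N : ℝ) - 1) * ‖p - w‖ ^ 2
    + (1 + lam) * ((N : ℝ) - 1) * (augGap S us x p + ‖p - ps‖ ^ 2)
    + ((N : ℝ) - 1 - lam * N) * (4 * S.mu ^ 2 - ‖p - ps‖ ^ 2)

theorem potential_nonneg (hS : S.Assumptions) (h : S.IsSaddlePoint us ps) (hN : 1 ≤ (N : ℝ))
    {lam : ℝ} (hlam0 : 0 ≤ lam) (hlam1 : lam * N ≤ N - 1) {x : PrimalSpace n} (hx : x ∈ S.U)
    {p : DualSpace m} (hp : ‖p‖ ≤ S.mu) (hps : ‖ps‖ ≤ S.mu) (w : DualSpace m) :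
    0 ≤ potential S us ps w lam x p := by
  have h1 := augGap_add_nonneg hS h hx p
  have h2 : ‖p - ps‖ ^ 2 ≤ (2 * S.mu) ^ 2 :=
    pow_le_pow_left₀ (norm_nonneg _) ((norm_sub_le _ _).trans (by linarith)) 2
  have h3 : 0 ≤ (2 * (N : ℝ) - 1) * ‖p - w‖ ^ 2 := mul_nonneg (by linarith) (sq_nonneg _)
  have h4 : 0 ≤ (1 + lam) * ((N : ℝ) - 1) * (augGap S us x p + ‖p - ps‖ ^ 2) :=
    mul_nonneg (mul_nonneg (by linarith) (by linarith)) h1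
  have h5 : 0 ≤ ((N : ℝ) - 1 - lam * N) * (4 * S.mu ^ 2 - ‖p - ps‖ ^ 2) :=
    mul_nonneg (by linarith) (by linarith)
  unfold potential
  linarith

/-- Dual step in terms of the Lagrangian gaps, when the correction of the projection does not
point along the step. -/
theorem augGap_dual_step (hS : S.Assumptions) (hN : 1 ≤ (N : ℝ)) {a : PrimalSpace n}
    {p v w : DualSpace m} (hw : w ∈ S.Cstar)
    (hv : dualUpdate S a p = p + ((S.rho / S.gamma) • (S.q a p - p) + v))
    (hproj : 0 ≤ inner ℝ v (w - (p + ((S.rho / S.gamma) • (S.q a p - p) + v))))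
    (hneg : inner ℝ v (S.q a p - p) ≤ 0) :
    ((N : ℝ) - 1) * augGap S us a (dualUpdate S a p) + lagGap S us a w
      + (2 * (N : ℝ) - 1) * (‖dualUpdate S a p - w‖ ^ 2 - ‖p - w‖ ^ 2)
      ≤ N * augGap S us a p := by
  rw [hv]
  exact dual_step_le hN rfl (rho_div_gamma_mul hS hN) hneg hproj (augGap_ge a p hw)
    (augGap_concave a p _)

/-- The dual inequality for w is added to λ times the one for p*. The coefficients of ‖p − p*‖² in
the potential combine to λ(2N−1), and the grouping in its definition only serves to exhibit
nonnegativity. The extra λ `lagGap` at p* is nonnegative and is dropped. -/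
theorem potential_step (hS : S.Assumptions) (h : S.IsSaddlePoint us ps) (hN : 1 ≤ (N : ℝ))
    (hμ : 0 ≤ S.mu) (hps : ‖ps‖ ≤ S.mu) {lam : ℝ} (hlam0 : 0 ≤ lam) {x a : PrimalSpace n}
    (ha : a ∈ S.U) {p w : DualSpace m} (hp : ‖p‖ ≤ S.mu) (hw : w ∈ S.Cstar) (hwμ : ‖w‖ ≤ S.mu) :
    potential S us ps w lam a (dualUpdate S a p) - potential S us ps w lam x p + lagGap S us a w
      ≤ (1 + lam) * (N * augGap S us a p - (N - 1) * augGap S us x p) := by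
  obtain ⟨v, hv, hproj⟩ := exists_dualUpdate_eq hμ a p
  have hr : 0 ≤ S.rho / S.gamma := by
    have := rho_div_gamma_mul hS hN
    by_contra! hneg
    nlinarith
  -- From inside the ball the correction cannot point along the step: otherwise ‖p‖ ≥ μ + ‖v‖ > μ.
  have hneg : inner ℝ v (S.q a p - p) ≤ 0 := by
    by_contra! hpos
    have hv0 : v ≠ 0 := by
      rintro rfl
      simp at hpos
    have := add_norm_le_of_inner_nonneg hr hv0 hμ hproj hpos.le
    have := norm_pos_iff.2 hv0
    linarith
  have h1 := augGap_dual_step (us := us) hS hN hw hv (hproj w hwμ) hneg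
  have h2 := mul_le_mul_of_nonneg_left
    (augGap_dual_step (us := us) hS hN h.2.1 hv (hproj ps hps) hneg) hlam0
  have h3 := mul_nonneg hlam0 (lagGap_saddle_nonneg hS h ha)
  unfold potential
  linarith

theorem le_slack (hN : 1 ≤ (N : ℝ)) (x a : PrimalSpace n) (p : DualSpace m) :
    (N : ℝ) / (N + 1) * ‖S.q a p - p‖ ^ 2 ≤ slack S x a p := by
  have e : S.q a p - p = (S.q x p - p) + (S.q a p - S.q x p) := by abel
  unfold slack
  rw [e, div_mul_eq_mul_div, div_le_iff₀ (by linarith), norm_add_sq_real]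
  have h1 := real_inner_le_norm (S.q x p - p) (S.q a p - S.q x p)
  have h2 := mul_le_mul_of_nonneg_left h1 (by linarith : 0 ≤ (N : ℝ))
  nlinarith [sq_nonneg (‖S.q x p - p‖ - N * ‖S.q a p - S.q x p‖)]

/-- The first dual step, from an arbitrary multiplier. -/
theorem exists_first_potential_le (hS : S.Assumptions) (h : S.IsSaddlePoint us ps)
    (hN : 1 ≤ (N : ℝ)) (hμ : 0 < S.mu) (hps : ‖ps‖ ≤ S.mu) {Smax : ℝ} {p : DualSpace m}
    (hSmax : ∀ w : DualSpace m, ‖w‖ ≤ S.mu → ‖p - w‖ ^ 2 ≤ Smax)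
    (x : PrimalSpace n) {a : PrimalSpace n} (ha : a ∈ S.U) :
    ∃ lam : ℝ, 0 ≤ lam ∧ lam * N ≤ N - 1 ∧ ∀ w ∈ S.Cstar, ‖w‖ ≤ S.mu →
      lagGap S us a w + potential S us ps w lam a (dualUpdate S a p)
        ≤ (2 * (N : ℝ) - 1) * augGap S us a p + (2 * (N : ℝ) - 1) / N * slack S x a p
          + 2 * N * Smax + (2 * (N : ℝ) - 1) * (N - 1) / N * ‖p - ps‖ ^ 2 := by
  obtain ⟨v, hv, hproj⟩ := exists_dualUpdate_eq hμ.le a p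
  have hN0 : (0 : ℝ) < N := by linarith
  have hrR := rho_div_gamma_mul hS hN
  have hr : 0 ≤ S.rho / S.gamma := by
    by_contra! hneg
    nlinarith
  have hlam : 0 ≤ ((N : ℝ) - 1) / N := div_nonneg (by linarith) hN0.le
  have hlamN : ((N : ℝ) - 1) / N * N = N - 1 := div_mul_cancel₀ _ hN0.ne'
  have hsl := le_slack (S := S) hN x a p
  -- For λ = (N−1)/N the last group of the potential vanishes.
  have hpot1 : ∀ w, potential S us ps w (((N : ℝ) - 1) / N) a (dualUpdate S a p)
      = (2 * (N : ℝ) - 1) * ‖dualUpdate S a p - w‖ ^ 2 + (2 * (N : ℝ) - 1) * (N - 1) / N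
        * (augGap S us a (dualUpdate S a p) + ‖dualUpdate S a p - ps‖ ^ 2) := by
    intro w
    unfold potential
    rw [hlamN, sub_self, zero_mul, add_zero]
    congr 2
    field_simp
    ring
  rcases le_or_gt (inner ℝ v (S.q a p - p)) 0 with hneg | hpos
  · refine ⟨((N : ℝ) - 1) / N, hlam, hlamN.le, fun w hw hwμ => ?_⟩
    have h1 := augGap_dual_step (us := us) hS hN hw hv (hproj w hwμ) hneg
    have h2 := mul_le_mul_of_nonneg_left
      (augGap_dual_step (us := us) hS hN h.2.1 hv (hproj ps hps) hneg) hlam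
    have h3 := mul_nonneg hlam (lagGap_saddle_nonneg hS h ha)
    have h4 : 0 ≤ (2 * (N : ℝ) - 1) / N * slack S x a p :=
      mul_nonneg (div_nonneg (by linarith) hN0.le) (le_trans (by positivity) hsl)
    have h5 := hSmax w hwμ
    have h6 : (2 * (N : ℝ) - 1) * ‖p - w‖ ^ 2 ≤ 2 * N * Smax :=
      mul_le_mul (by linarith) h5 (sq_nonneg _) (by linarith)
    rw [hpot1]
    have e1 : (2 * (N : ℝ) - 1) * (N - 1) / N = (N - 1) + (N - 1) / N * (N - 1) := by
      field_simp
      ring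
    have e2 : (2 * (N : ℝ) - 1) * (N - 1) / N = (N - 1) / N * (2 * N - 1) := by ring
    have e3 : (N : ℝ) * augGap S us a p + (N - 1) / N * (N * augGap S us a p)
        = (2 * N - 1) * augGap S us a p := by
      field_simp
      ring
    have e4 : (2 * (N : ℝ) - 1) * (N - 1) / N
        * (augGap S us a (dualUpdate S a p) + ‖dualUpdate S a p - ps‖ ^ 2)
        = ((N - 1) + (N - 1) / N * (N - 1)) * augGap S us a (dualUpdate S a p)
          + (N - 1) / N * (2 * N - 1) * ‖dualUpdate S a p - ps‖ ^ 2 := by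
      rw [mul_add, ← e1, ← e2]
    rw [e4, e2]
    linarith
  · have hv0 : v ≠ 0 := by
      rintro rfl
      simp at hpos
    have hp := add_norm_le_of_inner_nonneg hr hv0 hμ.le hproj hpos.le
    have hp0 : 0 < ‖p‖ := by linarith [norm_nonneg v]
    have hS' : (‖p‖ + S.mu) ^ 2 ≤ Smax := by
      -- The point of the ball opposite to p realises the largest distance ‖p‖ + μ.
      have h1 := hSmax (-(S.mu / ‖p‖) • p) (by
        rw [norm_smul, norm_neg, Real.norm_of_nonneg (by positivity), div_mul_cancel₀ _ hp0.ne'])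
      have e : p - -(S.mu / ‖p‖) • p = (1 + S.mu / ‖p‖) • p := by module
      rw [e, norm_smul, Real.norm_of_nonneg (by positivity), add_mul, one_mul,
        div_mul_cancel₀ _ hp0.ne'] at h1
      exact h1
    have hp1 := norm_dualUpdate_le hμ.le a p
    rw [hv] at hp1
    have hAs : 2 * inner ℝ (p - ps) (S.q a p - p) + ‖S.q a p - p‖ ^ 2 ≤ augGap S us a p := by
      linarith [augGap_ge (us := us) a p h.2.1, lagGap_saddle_nonneg hS h ha]
    have eQ : p + (S.q a p - p) - ps = S.q a p - ps := by abel
    rcases le_total ‖S.q a p - ps‖ (2 * S.mu) with hQ | hQ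
    · refine ⟨((N : ℝ) - 1) / N, hlam, hlamN.le, fun w hw hwμ => ?_⟩
      rw [hpot1, ← add_assoc, hv]
      exact first_dual_step_le_of_near hN rfl hrR (augGap_ge a p hw) hAs (augGap_concave a p _)
        hwμ hp1 hp hS' hsl (by rwa [eQ])
    -- For λ = 0 the ‖p − p*‖² terms of the potential cancel and leave (N−1)(`augGap` + 4μ²), the
    -- form of the far estimate.
    · refine ⟨0, le_rfl, by linarith, fun w hw hwμ => ?_⟩
      have h1 := first_dual_step_le_of_far hN rfl hrR (augGap_ge (us := us) a p hw) hAs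
        (augGap_concave a p _) hwμ hp1 hp hS' hsl (by rwa [eQ])
      rw [← hv] at h1
      unfold potential
      linarith

end DualAnalysis

/-! ### Summing the steps along a path and in expectation -/

section Summation

variable {N m : ℕ} {n : Fin N → ℕ} {S : Setting n m} {us : PrimalSpace n} {ps : DualSpace m}
  {W : Type*} {blk : ℕ → W → Fin N}
  {u : ℕ → W → PrimalSpace n} {p : ℕ → W → DualSpace m} {eps : ℕ → W → ℝ}

theorem p_succ_eq (hrun : S.IsRun blk u p eps) (k : ℕ) (ω : W) :
    p (k + 1) ω = dualUpdate S (u (k + 1) ω) (p k ω) := hrun.p_succ k ω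

/-- The summand controlled by the primal step. -/
noncomputable def primalTerm (S : Setting n m) (us : PrimalSpace n) (u : ℕ → W → PrimalSpace n)
    (p : ℕ → W → DualSpace m) (k : ℕ) (ω : W) : ℝ :=
  N * augGap S us (u (k + 1) ω) (p k ω) - (N - 1) * augGap S us (u k ω) (p k ω)
    + slack S (u k ω) (u (k + 1) ω) (p k ω)

/-- Pathwise bound of the weighted sum of the Lagrangian gaps. -/
theorem sum_lagGap_le (hS : S.Assumptions) (hrun : S.IsRun blk u p eps)
    (h : S.IsSaddlePoint us ps) (hN : 1 ≤ (N : ℝ)) (hμ : 0 < S.mu) (hps : ‖ps‖ ≤ S.mu) {Smax : ℝ}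
    {ω : W} {lam : ℝ} (hlam0 : 0 ≤ lam) (hlam1 : lam * N ≤ N - 1) {w : DualSpace m}
    (hw : w ∈ S.Cstar) (hwμ : ‖w‖ ≤ S.mu)
    (hfirst : lagGap S us (u 1 ω) w + potential S us ps w lam (u 1 ω) (p 1 ω)
        ≤ (2 * (N : ℝ) - 1) * augGap S us (u 1 ω) S.p0
          + (2 * (N : ℝ) - 1) / N * slack S S.u0 (u 1 ω) S.p0
          + 2 * N * Smax + (2 * (N : ℝ) - 1) * (N - 1) / N * ‖S.p0 - ps‖ ^ 2) (t : ℕ) :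
    ∑ k ∈ Finset.range (t + 1), eps k ω * lagGap S us (u (k + 1) ω) w
      ≤ (2 * (N : ℝ) - 1) / N * eps 0 ω * primalTerm S us u p 0 ω
        + ∑ k ∈ Finset.range t, (1 + lam) * eps (k + 1) ω * primalTerm S us u p (k + 1) ω
        + S.eps0 * (2 * N * Smax + (2 * (N : ℝ) - 1) * (N - 1) / N
          * (augGap S us S.u0 S.p0 + ‖S.p0 - ps‖ ^ 2)) := by
  have hN0 : (0 : ℝ) < N := by linarith
  have hpμ : ∀ k, ‖p (k + 1) ω‖ ≤ S.mu := fun k => by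
    rw [p_succ_eq hrun]
    exact norm_dualUpdate_le hμ.le _ _
  set Ψ : ℕ → ℝ := fun k => potential S us ps w lam (u (k + 1) ω) (p (k + 1) ω) with hΨ
  have hΨ0 : ∀ k, 0 ≤ Ψ k := fun k =>
    potential_nonneg hS h hN hlam0 hlam1 (hrun.u_succ_mem k ω) (hpμ k) hps w
  have habel := sum_antitone_mul_sub_ge (e := fun k => eps (k + 1) ω) (f := Ψ)
    (fun k => hrun.eps_succ_le (k + 1) ω) (fun k => (hrun.eps_pos hS (k + 1) ω).le) hΨ0 t
  have hlater : ∑ k ∈ Finset.range t, eps (k + 1) ω * lagGap S us (u (k + 2) ω) w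
      ≤ ∑ k ∈ Finset.range t, (1 + lam) * eps (k + 1) ω * primalTerm S us u p (k + 1) ω
        - ∑ k ∈ Finset.range t, eps (k + 1) ω * (Ψ (k + 1) - Ψ k) := by
    rw [← Finset.sum_sub_distrib]
    refine Finset.sum_le_sum fun k _ => ?_
    have h1 := potential_step (x := u (k + 1) ω) hS h hN hμ.le hps hlam0
      (hrun.u_succ_mem (k + 1) ω) (hpμ k) hw hwμ
    rw [← p_succ_eq hrun] at h1
    have h2 : 0 ≤ slack S (u (k + 1) ω) (u (k + 2) ω) (p (k + 1) ω) := by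
      unfold slack
      positivity
    have h3 : Ψ (k + 1) - Ψ k + lagGap S us (u (k + 2) ω) w
        ≤ (1 + lam) * primalTerm S us u p (k + 1) ω := by
      have h4 := mul_nonneg (by linarith : 0 ≤ 1 + lam) h2
      simp only [hΨ, primalTerm, mul_add] at h1 h4 ⊢
      linarith
    have h5 := mul_le_mul_of_nonneg_left h3 (hrun.eps_pos hS (k + 1) ω).le
    linarith
  rw [Finset.sum_range_succ']
  have h0 := mul_le_mul_of_nonneg_left hfirst (hrun.eps_pos hS 0 ω).le
  -- Summation by parts leaves ε¹Ψ 0, while the first step bounds ε⁰Ψ 0; nonnegativity of Ψ links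
  -- them.
  have h01 : eps 1 ω * Ψ 0 ≤ eps 0 ω * Ψ 0 :=
    mul_le_mul_of_nonneg_right (hrun.eps_succ_le 0 ω) (hΨ0 0)
  have hterm : (2 * (N : ℝ) - 1) / N * eps 0 ω * primalTerm S us u p 0 ω
      = eps 0 ω * ((2 * (N : ℝ) - 1) * augGap S us (u 1 ω) S.p0
          + (2 * (N : ℝ) - 1) / N * slack S S.u0 (u 1 ω) S.p0
          - (2 * (N : ℝ) - 1) * (N - 1) / N * augGap S us S.u0 S.p0) := by
    simp only [primalTerm, hrun.u_zero, hrun.p_zero, zero_add]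
    field_simp
    ring
  rw [hterm, ← hrun.eps_zero_eq ω]
  simp only [zero_add] at habel ⊢
  have h02 : Ψ 0 = potential S us ps w lam (u 1 ω) (p 1 ω) := rfl
  rw [← h02] at h0
  linarith

variable [MeasurableSpace W] {P : Measure W} [IsProbabilityMeasure P]

/-- Bound in expectation of the weighted sum of the Lagrangian gaps, uniformly over multipliers
that may depend on the whole path. -/
theorem integral_sum_lagGap_le (hS : S.Assumptions) (hrun : S.IsRun blk u p eps)
    (hblk : ∀ k, Measurable (blk k)) (hindep : iIndepFun blk P)
    (hunif : ∀ k j, P.real {ω | blk k ω = j} = 1 / (N : ℝ))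
    (h : S.IsSaddlePoint us ps) (hN : 0 < N) (hμ : 0 < S.mu) (hps : ‖ps‖ ≤ S.mu) {Smax : ℝ}
    (hSmax : ∀ w : DualSpace m, ‖w‖ ≤ S.mu → ‖S.p0 - w‖ ^ 2 ≤ Smax) (t : ℕ)
    {w : W → DualSpace m} (hwd : DeterminedBy blk (t + 1) w) (hw : ∀ ω, w ω ∈ S.Cstar)
    (hwμ : ∀ ω, ‖w ω‖ ≤ S.mu) :
    ∫ ω, ∑ k ∈ Finset.range (t + 1), eps k ω * lagGap S us (u (k + 1) ω) (w ω) ∂P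
      ≤ 2 * S.gamma * (2 * (N : ℝ) - 1) * S.D us S.u0
        + S.eps0 * (2 * N * Smax + (2 * (N : ℝ) - 1) * (N - 1) / N
          * (augGap S us S.u0 S.p0 + ‖S.p0 - ps‖ ^ 2)) := by
  have hN1 : (1 : ℝ) ≤ N := by exact_mod_cast hN
  have hN0 : (0 : ℝ) < N := by linarith
  have hlam := fun a (ha : a ∈ S.U) =>
    exists_first_potential_le hS h hN1 hμ hps hSmax S.u0 ha
  choose! lam hlam0 hlam1 hlam2 using hlam
  -- The weight depends on u¹ alone, hence on the first draw; so 1 + λ is an admissible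
  -- past-dependent weight in every later primal step.
  set L : W → ℝ := fun ω => lam (u 1 ω) with hL
  have hL0 : ∀ ω, 0 ≤ L ω := fun ω => hlam0 _ (hrun.u_succ_mem 0 ω)
  have hL1 : ∀ ω, L ω * N ≤ N - 1 := fun ω => hlam1 _ (hrun.u_succ_mem 0 ω)
  have hLd : DeterminedBy blk 1 L := fun ω ω' hω => by
    simp only [hL, hrun.determined_u hS le_rfl ω ω' hω]
  set c : ℝ := (2 * (N : ℝ) - 1) / N with hc
  have hc0 : 0 ≤ c := div_nonneg (by linarith) hN0.le
  have hterm : ∀ k, DeterminedBy blk (k + 1) (primalTerm S us u p k) := fun k ω ω' hω => by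
    simp only [primalTerm, hrun.determined_u hS le_rfl ω ω' hω,
      hrun.determined_u hS k.le_succ ω ω' hω, hrun.determined_p hS k.le_succ ω ω' hω]
  have hint0 : Integrable (fun ω => c * eps 0 ω * primalTerm S us u p 0 ω) P := by
    refine DeterminedBy.integrable (k := 1) hblk fun ω ω' hω => ?_
    simp only [hterm 0 ω ω' hω, hrun.determined_eps hS (Nat.zero_le 1) ω ω' hω]
  have hint1 : ∀ k, Integrable
      (fun ω => (1 + L ω) * eps (k + 1) ω * primalTerm S us u p (k + 1) ω) P := by
    intro k
    refine DeterminedBy.integrable (k := k + 2) hblk fun ω ω' hω => ?_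
    simp only [hterm (k + 1) ω ω' hω, hrun.determined_eps hS (k + 1).le_succ ω ω' hω,
      hLd.mono (by lia : 1 ≤ k + 2) ω ω' hω]
  have hDint : ∀ k, Integrable
      (fun ω => (1 + L ω) * (S.D us (u (k + 1) ω) - S.D us (u (k + 2) ω))) P := by
    intro k
    refine DeterminedBy.integrable (k := k + 2) hblk fun ω ω' hω => ?_
    simp only [hrun.determined_u hS (k + 1).le_succ ω ω' hω,
      hrun.determined_u hS le_rfl ω ω' hω, hLd.mono (by lia : 1 ≤ k + 2) ω ω' hω]
  have hDint0 : Integrable (fun ω => c * (S.D us (u 0 ω) - S.D us (u 1 ω))) P := by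
    refine DeterminedBy.integrable (k := 1) hblk fun ω ω' hω => ?_
    simp only [hrun.determined_u hS (Nat.zero_le 1) ω ω' hω,
      hrun.determined_u hS le_rfl ω ω' hω]
  have hstep := integral_primal_step hS hrun hblk hindep hunif h.1
    (inner_Theta_nonpos_of_saddle h).1 hN
  have h0 := hstep 0 (w := fun _ => c) (fun _ _ _ => rfl) (fun _ => hc0)
  have h1 : ∀ k, ∫ ω, (1 + L ω) * eps (k + 1) ω * primalTerm S us u p (k + 1) ω ∂P
      ≤ 2 * S.gamma * N
        * ∫ ω, (1 + L ω) * (S.D us (u (k + 1) ω) - S.D us (u (k + 2) ω)) ∂P := by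
    intro k
    refine hstep (k + 1) (w := fun ω => 1 + L ω) (fun ω ω' hω => ?_) fun ω => ?_
    · simp only [hLd.mono (by lia : 1 ≤ k + 1) ω ω' hω]
    · linarith [hL0 ω]
  have hpath : ∫ ω, ∑ k ∈ Finset.range (t + 1), eps k ω * lagGap S us (u (k + 1) ω) (w ω) ∂P
      ≤ ∫ ω, (c * eps 0 ω * primalTerm S us u p 0 ω
        + ∑ k ∈ Finset.range t, (1 + L ω) * eps (k + 1) ω * primalTerm S us u p (k + 1) ω
        + S.eps0 * (2 * N * Smax + (2 * (N : ℝ) - 1) * (N - 1) / N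
          * (augGap S us S.u0 S.p0 + ‖S.p0 - ps‖ ^ 2))) ∂P := by
    refine integral_mono ?_ ?_ fun ω => ?_
    · refine DeterminedBy.integrable (k := t + 1) hblk fun ω ω' hω => ?_
      refine Finset.sum_congr rfl fun k hk => ?_
      have hk' := Finset.mem_range.1 hk
      simp only [hrun.determined_u hS hk' ω ω' hω, hrun.determined_eps hS hk'.le ω ω' hω,
        hwd ω ω' hω]
    · exact (hint0.add (integrable_finsetSum _ fun k _ => hint1 k)).add (integrable_const _)
    · refine sum_lagGap_le hS hrun h hN1 hμ hps (hL0 ω) (hL1 ω) (hw ω) (hwμ ω) ?_ t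
      have h2 := hlam2 _ (hrun.u_succ_mem 0 ω) (w ω) (hw ω) (hwμ ω)
      have h3 := p_succ_eq hrun 0 ω
      rw [hrun.p_zero] at h3
      rw [h3]
      exact h2
  refine hpath.trans ?_
  have hintS : Integrable (fun ω => ∑ k ∈ Finset.range t,
      (1 + L ω) * eps (k + 1) ω * primalTerm S us u p (k + 1) ω) P :=
    integrable_finsetSum _ fun k _ => hint1 k
  have hintA : Integrable (fun ω => c * eps 0 ω * primalTerm S us u p 0 ω
      + ∑ k ∈ Finset.range t, (1 + L ω) * eps (k + 1) ω * primalTerm S us u p (k + 1) ω) P :=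
    hint0.add hintS
  rw [integral_add hintA (integrable_const _), integral_add hint0 hintS,
    integral_finsetSum _ fun k _ => hint1 k, integral_const, probReal_univ, one_smul]
  have hDintS : Integrable (fun ω => ∑ k ∈ Finset.range t,
      (1 + L ω) * (S.D us (u (k + 1) ω) - S.D us (u (k + 2) ω))) P :=
    integrable_finsetSum _ fun k _ => hDint k
  have hsum : ∫ ω, c * (S.D us (u 0 ω) - S.D us (u 1 ω)) ∂P
      + ∑ k ∈ Finset.range t, ∫ ω, (1 + L ω) * (S.D us (u (k + 1) ω) - S.D us (u (k + 2) ω)) ∂P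
      ≤ c * S.D us S.u0 := by
    rw [← integral_finsetSum _ fun k _ => hDint k,
      ← integral_add hDint0 hDintS]
    have hconst : c * S.D us S.u0 = ∫ _, c * S.D us S.u0 ∂P := by simp
    rw [hconst]
    refine integral_mono (hDint0.add hDintS)
      (integrable_const _) fun ω => ?_
    simp only
    rw [← Finset.mul_sum, Finset.sum_range_sub' (fun k => S.D us (u (k + 1) ω)) t, hrun.u_zero]
    have hD1 := hS.D_nonneg h.1 (hrun.u_succ_mem 0 ω)
    have hDt := hS.D_nonneg h.1 (hrun.u_succ_mem t ω)
    -- The weight of D drops from c to 1 + λ after the first step, so telescoping keeps the right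
    -- sign at D(u*, u¹).
    have hLc : 1 + L ω ≤ c := by
      rw [hc, le_div_iff₀ hN0]
      linarith [hL1 ω]
    have h2 := mul_le_mul_of_nonneg_right hLc hD1
    have h3 := mul_nonneg (by linarith [hL0 ω] : 0 ≤ 1 + L ω) hDt
    linarith
  have hγN : 0 ≤ 2 * S.gamma * N := by
    have := hS.gamma_pos
    positivity
  have hsum' := mul_le_mul_of_nonneg_left hsum hγN
  have hall : ∑ k ∈ Finset.range t, ∫ ω, (1 + L ω) * eps (k + 1) ω
      * primalTerm S us u p (k + 1) ω ∂P
      ≤ 2 * S.gamma * N * ∑ k ∈ Finset.range t,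
        ∫ ω, (1 + L ω) * (S.D us (u (k + 1) ω) - S.D us (u (k + 2) ω)) ∂P := by
    rw [Finset.mul_sum]
    exact Finset.sum_le_sum fun k _ => h1 k
  have h0' : ∫ ω, c * eps 0 ω * primalTerm S us u p 0 ω ∂P
      ≤ 2 * S.gamma * N * ∫ ω, c * (S.D us (u 0 ω) - S.D us (u 1 ω)) ∂P := h0
  have e : 2 * S.gamma * N * (c * S.D us S.u0)
      = 2 * S.gamma * (2 * (N : ℝ) - 1) * S.D us S.u0 := by
    rw [hc]
    field_simp
  linarith

end Summation

/-! ### Comparison with d₃ and from Lagrangian gap to optimality gap -/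

section Rate

variable {N m : ℕ} {n : Fin N → ℕ} {S : Setting n m} {us : PrimalSpace n} {ps : DualSpace m}

theorem eps0_pos (hS : S.Assumptions) : 0 < S.eps0 := nextStep_pos hS hS.epsInit_pos _ _

/-- The bound `h₃(u*, ·)` is at most `d₃` on the closed ball. -/
theorem h3_le_d3 (hS : S.Assumptions) (hμ : 0 < S.mu) {w : DualSpace m} (hw : ‖w‖ ≤ S.mu) :
    S.h3 us ps us w ≤ S.d3 us ps := by
  have he : 0 ≤ S.eps0 / S.gamma := div_nonneg (eps0_pos hS).le hS.gamma_pos.le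
  have hbdd : BddAbove (S.h3 us ps us '' Metric.ball 0 S.mu) := by
    refine ⟨S.D us S.u0 + ((N : ℝ) - 1) / N * S.D us S.u0
      + S.eps0 / S.gamma * (S.mu + ‖S.p0‖) ^ 2
      + (2 * (N : ℝ) - 1) * ((N : ℝ) - 1) * S.eps0 / (N : ℝ) ^ 2
        * (‖ps - S.p0‖ ^ 2 / (2 * S.gamma) + S.Lgamma S.u0 S.p0 - S.L us ps), ?_⟩
    rintro _ ⟨v, hv, rfl⟩
    have hv' : ‖v‖ ≤ S.mu := (mem_ball_zero_iff.1 hv).le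
    have h1 : ‖v - S.p0‖ ^ 2 ≤ (S.mu + ‖S.p0‖) ^ 2 :=
      pow_le_pow_left₀ (norm_nonneg _) ((norm_sub_le _ _).trans (by linarith)) 2
    have h2 := mul_le_mul_of_nonneg_left h1 he
    unfold Setting.h3
    linarith
  have hcont : Continuous (S.h3 us ps us) := by
    unfold Setting.h3
    fun_prop
  have hclosed : IsClosed {v | S.h3 us ps us v ≤ S.d3 us ps} :=
    isClosed_le hcont continuous_const
  -- The supremum is over the open ball, whereas the multiplier used later has norm exactly μ when
  -- Π(Θ) ≠ 0; continuity passes to the closure.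
  have hsub : Metric.ball 0 S.mu ⊆ {v | S.h3 us ps us v ≤ S.d3 us ps} := fun v hv =>
    le_csSup hbdd ⟨v, hv, rfl⟩
  have h := closure_minimal hsub hclosed
  rw [closure_ball _ hμ.ne'] at h
  exact h (mem_closedBall_zero_iff.2 hw)

/-- Puts h₃ in the shape of the bound in `integral_sum_lagGap_le`, with ‖w − p⁰‖² in the role of
`Smax`. -/
theorem two_mul_h3 (hS : S.Assumptions) (h : S.IsSaddlePoint us ps) (hN : 0 < N)
    (w : DualSpace m) :
    2 * S.gamma * N * S.h3 us ps us w = 2 * S.gamma * (2 * (N : ℝ) - 1) * S.D us S.u0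
      + S.eps0 * (2 * N * ‖w - S.p0‖ ^ 2 + (2 * (N : ℝ) - 1) * (N - 1) / N
          * (augGap S us S.u0 S.p0 + ‖S.p0 - ps‖ ^ 2)) := by
  have hN0 : (0 : ℝ) < N := Nat.cast_pos.2 hN
  have hγ := hS.gamma_pos
  unfold Setting.h3 Setting.Lgamma augGap Setting.q
  rw [L_saddle h, norm_sub_rev ps]
  field_simp
  ring

theorem convexOn_F (hS : S.Assumptions) : ConvexOn ℝ S.U S.F := hS.G_convex.add hS.J_convex

theorem convexOn_L (hS : S.Assumptions) {w : DualSpace m} (hw : w ∈ S.Cstar) :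
    ConvexOn ℝ S.U fun x => S.L x w := by
  have h := (convexOn_F hS).add
    ((hS.convexOn_inner hS.Om_convex hw).add (hS.convexOn_inner hS.Ph_convex hw))
  refine h.congr fun x _ => ?_
  simp only [Setting.L, Pi.add_apply, inner_Theta]

/-- The multiplier that detects infeasibility of `x`. -/
noncomputable def witnessMultiplier (S : Setting n m) (x : PrimalSpace n) : DualSpace m :=
  (S.mu / ‖S.Pi (S.Theta x)‖) • S.Pi (S.Theta x)

theorem witnessMultiplier_mem (hμ : 0 ≤ S.mu) (x : PrimalSpace n) :
    witnessMultiplier S x ∈ S.Cstar :=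
  S.Cstar.smul_mem (Pi_mem S _) (by positivity)

theorem norm_witnessMultiplier_le (hμ : 0 ≤ S.mu) (x : PrimalSpace n) :
    ‖witnessMultiplier S x‖ ≤ S.mu := by
  unfold witnessMultiplier
  rw [norm_smul, Real.norm_of_nonneg (by positivity)]
  rw [div_mul_eq_mul_div]
  exact div_le_of_le_mul₀ (norm_nonneg _) hμ le_rfl

theorem lagGap_witnessMultiplier (x : PrimalSpace n) :
    lagGap S us x (witnessMultiplier S x)
      = 2 * S.gamma * (S.F x - S.F us + S.mu * ‖S.Pi (S.Theta x)‖) := by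
  have e : inner ℝ (witnessMultiplier S x) (S.Theta x) = S.mu * ‖S.Pi (S.Theta x)‖ := by
    unfold witnessMultiplier
    rw [real_inner_smul_left, inner_Pi_self]
    by_cases h : ‖S.Pi (S.Theta x)‖ = 0
    · simp [h]
    · field_simp
  unfold lagGap Setting.L
  rw [e]
  ring

/-- The saddle inequality gives F(x) − F(u*) ≥ −‖p*‖ ‖Π(Θ(x))‖, so weight μ > ‖p*‖ on the
infeasibility compensates a negative objective gap; the constant follows by splitting on its sign.
-/
theorem gap_le (h : S.IsSaddlePoint us ps) (hμ : 1 ≤ S.mu) (hps : ‖ps‖ < S.mu)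
    {x : PrimalSpace n} (hx : x ∈ S.U) :
    0 ≤ S.F x - S.F us + S.mu * ‖S.Pi (S.Theta x)‖ ∧
    (S.mu - ‖ps‖) * S.gap us x
      ≤ (S.mu + 1) * (S.F x - S.F us + S.mu * ‖S.Pi (S.Theta x)‖) := by
  have h1 := (h.2.2 x hx ps h.2.1).2
  rw [L_saddle h] at h1
  have h2 := inner_le_norm_mul_norm_Pi S (S.Theta x) h.2.1
  unfold Setting.L at h1
  unfold Setting.gap
  have h3 := norm_nonneg (S.Pi (S.Theta x))
  have h4 := norm_nonneg ps
  generalize ‖S.Pi (S.Theta x)‖ = g at *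
  have h5 : 0 ≤ S.F x - S.F us + ‖ps‖ * g := by linarith
  generalize S.F x - S.F us = d at *
  generalize ‖ps‖ = s at *
  generalize S.mu = M at *
  have h6 : 0 ≤ (M - s) * g := mul_nonneg (by linarith) h3
  refine ⟨by linarith, ?_⟩
  rcases abs_cases d with ⟨hd, hd0⟩ | ⟨hd, hd0⟩
  · rw [hd]
    have h7 : 0 ≤ (1 + s) * d := mul_nonneg (by linarith) hd0
    have h8 : 0 ≤ (M ^ 2 + s) * g := by positivity
    linarith
  · rw [hd]
    have h7 : 0 ≤ (2 * M - s + 1) * (d + s * g) := mul_nonneg (by linarith) h5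
    have h8 : 0 ≤ (M - s) ^ 2 * g := by positivity
    linarith

end Rate

/-! ### The averaged iterate and the rate in expectation -/

section Average

variable {N m : ℕ} {n : Fin N → ℕ} {S : Setting n m} {us : PrimalSpace n} {ps : DualSpace m}
  {W : Type*} {blk : ℕ → W → Fin N}
  {u : ℕ → W → PrimalSpace n} {p : ℕ → W → DualSpace m} {eps : ℕ → W → ℝ}

theorem sum_eps_pos (hS : S.Assumptions) (hrun : S.IsRun blk u p eps) (t : ℕ) (ω : W) :
    0 < ∑ k ∈ Finset.range (t + 1), eps k ω :=
  Finset.sum_pos (fun k _ => hrun.eps_pos hS k ω) ⟨0, by simp⟩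

theorem average_eq_centerMass (t : ℕ) (ω : W) : average u eps t ω
    = (Finset.range (t + 1)).centerMass (fun k => eps k ω) (fun k => u (k + 1) ω) := rfl

theorem average_mem (hS : S.Assumptions) (hrun : S.IsRun blk u p eps) (t : ℕ) (ω : W) :
    average u eps t ω ∈ S.U := by
  rw [average_eq_centerMass]
  exact hS.convex_U.centerMass_mem (fun k _ => (hrun.eps_pos hS k ω).le)
    (sum_eps_pos hS hrun t ω) fun k _ => hrun.u_succ_mem k ω

theorem determined_average (hS : S.Assumptions) (hrun : S.IsRun blk u p eps) (t : ℕ) :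
    DeterminedBy blk (t + 1) (average u eps t) := by
  intro ω ω' hω
  have h1 : ∀ k ∈ Finset.range (t + 1), eps k ω = eps k ω' := fun k hk =>
    hrun.determined_eps hS (Finset.mem_range.1 hk).le ω ω' hω
  have h2 : ∀ k ∈ Finset.range (t + 1), u (k + 1) ω = u (k + 1) ω' := fun k hk =>
    hrun.determined_u hS (Finset.mem_range.1 hk) ω ω' hω
  unfold average
  have h3 : ∀ k ∈ Finset.range (t + 1), eps k ω • u (k + 1) ω = eps k ω' • u (k + 1) ω' :=
    fun k hk => by rw [h1 k hk, h2 k hk]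
  rw [Finset.sum_congr rfl h1, Finset.sum_congr rfl h3]

theorem lagGap_average_le (hS : S.Assumptions) (hrun : S.IsRun blk u p eps) (t : ℕ) (ω : W)
    {w : DualSpace m} (hw : w ∈ S.Cstar) :
    (∑ k ∈ Finset.range (t + 1), eps k ω) * lagGap S us (average u eps t ω) w
      ≤ ∑ k ∈ Finset.range (t + 1), eps k ω * lagGap S us (u (k + 1) ω) w := by
  have hpos := sum_eps_pos hS hrun t ω
  have h := (convexOn_L hS hw).map_centerMass_le (t := Finset.range (t + 1))
    (w := fun k => eps k ω) (p := fun k => u (k + 1) ω)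
    (fun k _ => (hrun.eps_pos hS k ω).le) hpos fun k _ => hrun.u_succ_mem k ω
  rw [← average_eq_centerMass, Finset.centerMass] at h
  simp only [smul_eq_mul, Function.comp_apply] at h
  rw [inv_mul_eq_div, le_div_iff₀ hpos] at h
  have h1 : ∑ k ∈ Finset.range (t + 1), eps k ω * lagGap S us (u (k + 1) ω) w
      = 2 * S.gamma * (∑ k ∈ Finset.range (t + 1), eps k ω * S.L (u (k + 1) ω) w
        - (∑ k ∈ Finset.range (t + 1), eps k ω) * S.F us) := by
    rw [Finset.sum_mul, ← Finset.sum_sub_distrib, Finset.mul_sum]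
    refine Finset.sum_congr rfl fun k _ => ?_
    unfold lagGap
    ring
  rw [h1]
  have h2 := mul_le_mul_of_nonneg_left h (by linarith [hS.gamma_pos] : 0 ≤ 2 * S.gamma)
  unfold lagGap
  linarith

theorem determined_gap (hS : S.Assumptions) (hrun : S.IsRun blk u p eps) (t : ℕ) :
    DeterminedBy blk (t + 1) fun ω => S.gap us (average u eps t ω) := fun ω ω' hω => by
  simp only [determined_average hS hrun t ω ω' hω]

theorem gap_nonneg (x : PrimalSpace n) : 0 ≤ S.gap us x :=
  add_nonneg (abs_nonneg _) (norm_nonneg _)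

variable [MeasurableSpace W] {P : Measure W} [IsProbabilityMeasure P]

/-- The expected bound is applied with the multiplier detecting infeasibility of the random average
itself; Jensen's inequality for L(·, w) passes to the average. -/
theorem integral_gap_le (hS : S.Assumptions) (hrun : S.IsRun blk u p eps)
    (hblk : ∀ k, Measurable (blk k)) (hindep : iIndepFun blk P)
    (hunif : ∀ k j, P.real {ω | blk k ω = j} = 1 / (N : ℝ))
    (h : S.IsSaddlePoint us ps) (hN : 0 < N) (hμ0 : ‖ps‖ ≤ S.mu0) (t : ℕ) {epsLow : ℝ}
    (hlow : 0 < epsLow) (hepsLow : ∀ k ≤ t, ∀ᵐ ω ∂P, epsLow ≤ eps k ω) :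
    ∫ ω, S.gap us (average u eps t ω) ∂P ≤ S.rateBound us ps epsLow t := by
  have hN0 : (0 : ℝ) < N := Nat.cast_pos.2 hN
  have hγ := hS.gamma_pos
  have he0 := eps0_pos hS
  have hps : ‖ps‖ < S.mu := by
    unfold Setting.mu
    linarith
  have hμ : 1 ≤ S.mu := by
    have := norm_nonneg ps
    unfold Setting.mu
    linarith
  have hμpos : 0 < S.mu := by linarith
  obtain ⟨base, hbase⟩ : ∃ b, b = 2 * S.gamma * (2 * (N : ℝ) - 1) * S.D us S.u0
    + S.eps0 * ((2 * (N : ℝ) - 1) * (N - 1) / N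
          * (augGap S us S.u0 S.p0 + ‖S.p0 - ps‖ ^ 2)) := ⟨_, rfl⟩
  -- Solved from requiring the final bound to be 2γN d₃; it dominates ‖p⁰ − w‖² on the closed ball
  -- because h₃ ≤ d₃ there.
  set Smax : ℝ := (2 * S.gamma * N * S.d3 us ps - base) / (S.eps0 * (2 * N)) with hSmax
  have hSeq : base + S.eps0 * (2 * N) * Smax = 2 * S.gamma * N * S.d3 us ps := by
    rw [hSmax]
    field_simp
    ring
  have hS0 : ∀ w : DualSpace m, ‖w‖ ≤ S.mu → ‖S.p0 - w‖ ^ 2 ≤ Smax := by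
    intro w hw
    rw [hSmax, le_div_iff₀ (by positivity), norm_sub_rev]
    have h1 := two_mul_h3 hS h hN w
    have h2 := mul_le_mul_of_nonneg_left (h3_le_d3 (us := us) (ps := ps) hS hμpos hw)
      (by positivity : 0 ≤ 2 * S.gamma * N)
    linarith
  set V : W → ℝ := fun ω => S.F (average u eps t ω) - S.F us
    + S.mu * ‖S.Pi (S.Theta (average u eps t ω))‖ with hV
  have hVint : Integrable V P := DeterminedBy.integrable (k := t + 1) hblk fun ω ω' hω => by
    simp only [hV, determined_average hS hrun t ω ω' hω]
  have hwd : DeterminedBy blk (t + 1) fun ω => witnessMultiplier S (average u eps t ω) :=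
    fun ω ω' hω => by simp only [determined_average hS hrun t ω ω' hω]
  have hmain := integral_sum_lagGap_le hS hrun hblk hindep hunif h hN hμpos hps.le hS0 t hwd
    (fun ω => witnessMultiplier_mem hμpos.le _) (fun ω => norm_witnessMultiplier_le hμpos.le _)
  have hae : ∀ᵐ ω ∂P, ∀ k ∈ Finset.range (t + 1), epsLow ≤ eps k ω :=
    (Finset.eventually_all _).2 fun k hk =>
      hepsLow k (Nat.lt_succ_iff.1 (Finset.mem_range.1 hk))
  have hVle : 2 * S.gamma * (epsLow * (t + 1)) * ∫ ω, V ω ∂P ≤ 2 * S.gamma * N * S.d3 us ps := by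
    rw [← hSeq, ← integral_const_mul]
    refine le_trans (integral_mono_ae (hVint.const_mul _) ?_ ?_) (hmain.trans (le_of_eq ?_))
    · refine DeterminedBy.integrable (k := t + 1) hblk fun ω ω' hω => ?_
      refine Finset.sum_congr rfl fun k hk => ?_
      have hk' := Finset.mem_range.1 hk
      simp only [hrun.determined_u hS hk' ω ω' hω, hrun.determined_eps hS hk'.le ω ω' hω,
        hwd ω ω' hω]
    · filter_upwards [hae] with ω hω
      refine le_trans ?_ (lagGap_average_le hS hrun t ω (witnessMultiplier_mem hμpos.le _))
      rw [lagGap_witnessMultiplier]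
      have h1 : epsLow * (t + 1) ≤ ∑ k ∈ Finset.range (t + 1), eps k ω := by
        have := Finset.card_nsmul_le_sum _ _ _ hω
        rw [Finset.card_range, nsmul_eq_mul] at this
        push_cast at this
        linarith
      -- Replacing the sum of step sizes by its lower bound needs the nonnegativity half of
      -- `gap_le`.
      have h2 := mul_le_mul_of_nonneg_right h1 (mul_nonneg (by linarith : 0 ≤ 2 * S.gamma)
        (gap_le h hμ hps (average_mem hS hrun t ω)).1)
      simp only [hV]
      linarith
    · rw [hbase]
      ring
  have hgap : (S.mu - ‖ps‖) * ∫ ω, S.gap us (average u eps t ω) ∂P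
      ≤ (S.mu + 1) * ∫ ω, V ω ∂P := by
    rw [← integral_const_mul, ← integral_const_mul]
    exact integral_mono (((determined_gap hS hrun t).integrable hblk).const_mul _)
      (hVint.const_mul _) fun ω => (gap_le h hμ hps (average_mem hS hrun t ω)).2
  unfold Setting.rateBound
  have hd : 0 < S.mu - ‖ps‖ := by linarith
  have ht : (0 : ℝ) < t + 1 := by positivity
  rw [le_div_iff₀ (by positivity)]
  have h1 : epsLow * (t + 1) * ∫ ω, V ω ∂P ≤ N * S.d3 us ps := by
    refine le_of_mul_le_mul_left ?_ (by linarith : 0 < 2 * S.gamma)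
    linarith
  have h2 := mul_le_mul_of_nonneg_left h1 (by linarith : 0 ≤ S.mu + 1)
  have h3 := mul_le_mul_of_nonneg_right hgap (by positivity : 0 ≤ epsLow * ((t : ℝ) + 1))
  linarith

end Average

end SPDCL

theorem mainTheorem6 {N m : ℕ} {n : Fin N → ℕ} (S : SPDCL.Setting n m) (hS : S.Assumptions)
    (us : SPDCL.PrimalSpace n) (ps : SPDCL.DualSpace m) (hsaddle : S.IsSaddlePoint us ps)
    (hmu0 : ‖ps‖ ≤ S.mu0)
    {W : Type*} [MeasurableSpace W] (P : Measure W) [IsProbabilityMeasure P]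
    (blk : ℕ → W → Fin N) (hblk_meas : ∀ k, Measurable (blk k)) (hblk_indep : iIndepFun blk P)
    (hblk_unif : ∀ k j, P.real {ω | blk k ω = j} = 1 / (N : ℝ))
    (u : ℕ → W → SPDCL.PrimalSpace n) (p : ℕ → W → SPDCL.DualSpace m) (eps : ℕ → W → ℝ)
    (hrun : S.IsRun blk u p eps)
    (t : ℕ) (epsLow : ℝ) (hepsLow_pos : 0 < epsLow)
    (hepsLow : ∀ k ≤ t, ∀ᵐ ω ∂P, epsLow ≤ eps k ω) :
    Integrable (fun ω => S.gap us (SPDCL.average u eps t ω)) P ∧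
    ∫ ω, S.gap us (SPDCL.average u eps t ω) ∂P ≤ S.rateBound us ps epsLow t ∧
    ∀ ε η : ℝ, 0 < ε → 0 < η → η < 1 → S.threshold us ps epsLow ε η ≤ (t : ℝ) →
      1 - η ≤ P.real {ω | S.gap us (SPDCL.average u eps t ω) ≤ ε} ∧
      P.real {ω | ε ≤ S.gap us (SPDCL.average u eps t ω)}
        ≤ ε⁻¹ * ∫ ω, S.gap us (SPDCL.average u eps t ω) ∂P ∧
      ε⁻¹ * ∫ ω, S.gap us (SPDCL.average u eps t ω) ∂P ≤ ε⁻¹ * S.rateBound us ps epsLow t ∧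
      ε⁻¹ * S.rateBound us ps epsLow t ≤ η := by
  -- A probability space is nonempty, and any drawn block is an element of `Fin N`.
  have hN : 0 < N := by
    obtain ⟨ω⟩ : Nonempty W := P.nonempty_of_neZero
    exact Fin.pos (blk 0 ω)
  have hint : Integrable (fun ω => S.gap us (SPDCL.average u eps t ω)) P :=
    (SPDCL.determined_gap hS hrun t).integrable hblk_meas
  have hrate := SPDCL.integral_gap_le hS hrun hblk_meas hblk_indep hblk_unif hsaddle hN hmu0 t
    hepsLow_pos hepsLow
  refine ⟨hint, hrate, fun ε η hε hη _ ht => ?_⟩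
  have hmarkov : P.real {ω | ε ≤ S.gap us (SPDCL.average u eps t ω)}
      ≤ ε⁻¹ * ∫ ω, S.gap us (SPDCL.average u eps t ω) ∂P := by
    rw [inv_mul_eq_div, le_div_iff₀ hε, mul_comm]
    exact mul_meas_ge_le_integral_of_nonneg
      (Filter.Eventually.of_forall fun ω => SPDCL.gap_nonneg _) hint ε
  have hrate' : ε⁻¹ * ∫ ω, S.gap us (SPDCL.average u eps t ω) ∂P
      ≤ ε⁻¹ * S.rateBound us ps epsLow t :=
    mul_le_mul_of_nonneg_left hrate (inv_nonneg.2 hε.le)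
  have hη' : ε⁻¹ * S.rateBound us ps epsLow t ≤ η := by
    have hd : 0 < S.mu - ‖ps‖ := by
      unfold SPDCL.Setting.mu
      linarith
    have ht0 : (0 : ℝ) < t + 1 := by positivity
    unfold SPDCL.Setting.threshold at ht
    rw [sub_le_iff_le_add, div_le_iff₀ (by positivity)] at ht
    unfold SPDCL.Setting.rateBound
    rw [inv_mul_eq_div, div_le_iff₀ hε, div_le_iff₀ (by positivity)]
    linarith
  refine ⟨?_, hmarkov, hrate', hη'⟩
  have hmeas : MeasurableSet {ω | S.gap us (SPDCL.average u eps t ω) ≤ ε} :=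
    measurableSet_le ((SPDCL.determined_gap hS hrun t).measurable hblk_meas) measurable_const
  have hcompl : P.real {ω | S.gap us (SPDCL.average u eps t ω) ≤ ε}ᶜ
      ≤ P.real {ω | ε ≤ S.gap us (SPDCL.average u eps t ω)} :=
    measureReal_mono fun ω hω => by
      simp only [Set.mem_compl_iff, Set.mem_ofPred_eq, not_le] at hω ⊢
      exact hω.le
  rw [probReal_compl_eq_one_sub hmeas] at hcompl
  linarith
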